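/- Let $N$ be a free abelian group of rank $n$, $N_{\mathbb R}=N\otimes\mathbb R$, $M=\mathrm{Hom}(N,\mathbb Z)$ with the pairing $\langle\cdot,\cdot\rangle:M\times N_{\mathbb R}\to\mathbb R$, let $M'\subset N_{\mathbb R}$ be a lattice, and let $X=N_{\mathbb R}/M'$ be the real torus with integral structure $N$. Put $\mathbb T=\mathbb R\cup\{+\infty\}$. *Polarizations.* A homomorphism $\lambda:M'\to M$ is a polarization if $\langle\lambda(\cdot),\cdot\rangle$ on $M'\times M'$ extends to a symmetric positive-definite $\mathbb R$-bilinear form on $N_{\mathbb R}$; $X$ is a tropical abelian variety if it has a polarization. *Tropical line bundles.* A map between subsets of real vector spaces $\mathbb R^m,\mathbb R^k$ is a tropical morphism if locally it is the restriction of a $\mathbb Z$-affine map $x\mapsto Ax+b$ ($A$ an integral matrix, $b$ a real vector). $X$ is a rational polyhedral space, with charts given by local inverses of $N_{\mathbb R}\to X$ in coordinates of a $\mathbb Z$-basis of $N$, and all rational polyhedral atlases equivalent to these. A tropical line bundle on $X$ is a space $L\to X$ with local trivializations $L|_{X_i}\cong X_i\times\mathbb T$ over the charts of an atlas whose transitions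 have the form $(x,a)\mapsto(x,a+t_{ij}(x))$ with $t_{ij}$ a tropical morphism to $\mathbb R$. For $d\ge1$, $dL$ is the tropical line bundle with transition functions $d\,t_{ij}$. Isomorphisms are homeomorphisms over $X$ of the form $(x,a)\mapsto(x,a+t(x))$ in local trivializations, with $t$ a tropical morphism. A tropical descent datum is a pair of a homomorphism $\lambda:M'\to M$ and a map $\gamma:M'\to\mathbb R$ with $\gamma(u_1+u_2)-\gamma(u_1)-\gamma(u_2)=\langle\lambda(u_2),u_1\rangle$; it gives the line bundle $L(\lambda,\gamma)=(N_{\mathbb R}\times\mathbb T)/M'$ for the action $u\cdot(x,t)=(x+u,\;t-\langle\lambda(u),x\rangle-\gamma(u))$. A tropical line bundle $L$ is positive if $L\cong L(\lambda,\gamma)$ for a tropical descent datum such that $\lambda$ is a polarization. *Faithful embeddings.* A nontrivial regular global section of $L$ is a section given in the local trivializations and charts by real-valued functions that are locally concave and piecewise $\mathbb Z$-affine. Such sections $s_0,\dots,s_m$ define a map $\varphi:X\to\mathbb{TP}^m$, $x\mapsto(s_0(x):\dots:s_m(x))$, into the maximal tropical torus $\{(0:a_1:\dots:a_m)\mid a_i\in\mathbb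 R\}\cong\mathbb R^m$ of tropical projective space. They give a faithful embedding if $\varphi$ is a homeomorphism onto its image and is unimodular, i.e. for some atlas of $X$, in each chart there is a rational polyhedral complex, with the image of the chart open in its support, on each of whose cells $\varphi$ agrees with a $\mathbb Z$-affine map $x\mapsto Ax+b$ such that the integral $m\times r$ matrix $A$ ($r$ the dimension of the ambient space of the chart) has rank $r$ and $\mathbb Z^m/A\mathbb Z^r$ is torsion-free. The bundle $L$ admits a faithful embedding of $X$ if finitely many nontrivial regular global sections of $L$ give a faithful embedding. **Statement.** Let $X$ be a tropical abelian variety of dimension $n$ and let $L$ be a positive tropical line bundle on $X$. Then for every integer $d\ge\max\{3,\,2\,(n-1)!\}$ the tropical line bundle $dL$ admits a faithful embedding of $X$. (For $n=0$ read $(n-1)!$ as $1$.) -/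

import Mathlib

open Set Filter Topology Bundle

universe u v w

/-! ### Polyhedra and polyhedral complexes in `ℝ^m` -/

/-- The polyhedron in `ℝ^m` cut out by a finite system of inequalities `⟨v, x⟩ ≥ b`,
the system being a finite set of pairs `(v, b)`. -/
def polyhedronOf {m : ℕ} (H : Finset ((Fin m → ℝ) × ℝ)) : Set (Fin m → ℝ) :=
  {x | ∀ h ∈ H, h.2 ≤ h.1 ⬝ᵥ x}

/-- Polyhedra in `ℝ^m`. -/
def IsPolyhedron {m : ℕ} (σ : Set (Fin m → ℝ)) : Prop :=
  ∃ H : Finset ((Fin m → ℝ) × ℝ), σ = polyhedronOf H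

/-- Rational polyhedra: the vectors `v` can be taken in `ℤ^m` (the constants `b` are real). -/
def IsRationalPolyhedron {m : ℕ} (σ : Set (Fin m → ℝ)) : Prop :=
  ∃ H : Finset ((Fin m → ℝ) × ℝ),
    (∀ h ∈ H, ∃ v : Fin m → ℤ, ∀ i, h.1 i = (v i : ℝ)) ∧ σ = polyhedronOf H

/-- `τ` is a face of `σ`: it arises by changing some (possibly none) of the inequalities
of a finite system defining `σ` into equalities. -/
def IsFace {m : ℕ} (τ σ : Set (Fin m → ℝ)) : Prop :=
  ∃ H J : Finset ((Fin m → ℝ) × ℝ), J ⊆ H ∧ σ = polyhedronOf H ∧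
    τ = {x | x ∈ σ ∧ ∀ h ∈ J, h.1 ⬝ᵥ x = h.2}

/-- Polyhedral complexes in `ℝ^m`. Whether the empty set belongs to `C` is left open. -/
structure IsPolyhedralComplex {m : ℕ} (C : Set (Set (Fin m → ℝ))) : Prop where
  isPolyhedron : ∀ σ ∈ C, IsPolyhedron σ
  locallyFinite : LocallyFinite (fun σ : C => (σ : Set (Fin m → ℝ)))
  face_mem : ∀ σ ∈ C, ∀ τ, IsFace τ σ → τ.Nonempty → τ ∈ C
  inter_isFace : ∀ σ ∈ C, ∀ σ' ∈ C, (σ ∩ σ').Nonempty → IsFace (σ ∩ σ') σ ∧ IsFace (σ ∩ σ') σ'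

/-- Rational polyhedral complexes. -/
def IsRationalPolyhedralComplex {m : ℕ} (C : Set (Set (Fin m → ℝ))) : Prop :=
  IsPolyhedralComplex C ∧ ∀ σ ∈ C, IsRationalPolyhedron σ

/-- `U` is an open subset of the underlying set `|C| = ⋃₀ C`. -/
def IsOpenInSupport {m : ℕ} (C : Set (Set (Fin m → ℝ))) (U : Set (Fin m → ℝ)) : Prop :=
  ∃ O : Set (Fin m → ℝ), IsOpen O ∧ U = O ∩ ⋃₀ C

/-- Open rational polyhedral sets. -/
def IsOpenRationalPolyhedral {m : ℕ} (U : Set (Fin m → ℝ)) : Prop :=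
  ∃ C, IsRationalPolyhedralComplex C ∧ IsOpenInSupport C U

/-! ### `ℤ`-affine maps and tropical morphisms -/

/-- `F x = A x + b` with an integral matrix `A` and a real vector `b`. -/
def IsZAffine {m k : ℕ} (F : (Fin m → ℝ) → (Fin k → ℝ)) : Prop :=
  ∃ (A : Matrix (Fin k) (Fin m) ℤ) (b : Fin k → ℝ),
    ∀ x, F x = (A.map (Int.cast : ℤ → ℝ)).mulVec x + b

/-- `ℤ`-affine functions `ℝ^m → ℝ`. -/
def IsZAffineFunction {m : ℕ} (f : (Fin m → ℝ) → ℝ) : Prop :=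
  ∃ (a : Fin m → ℤ) (b : ℝ), ∀ x, f x = ∑ i, (a i : ℝ) * x i + b

/-- Tropical morphisms on `U`: locally on `U` the restriction of a `ℤ`-affine map. -/
def IsTropicalMorphismOn {m k : ℕ} (φ : (Fin m → ℝ) → (Fin k → ℝ)) (U : Set (Fin m → ℝ)) : Prop :=
  ∀ p ∈ U, ∃ F, IsZAffine F ∧ φ =ᶠ[𝓝[U] p] F

/-- Tropical morphisms from `U` to `ℝ`. -/
def IsTropicalFunctionOn {m : ℕ} (φ : (Fin m → ℝ) → ℝ) (U : Set (Fin m → ℝ)) : Prop :=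
  ∀ p ∈ U, ∃ F, IsZAffineFunction F ∧ φ =ᶠ[𝓝[U] p] F

/-- Piecewise `ℤ`-affine functions on `ℝ^m`. -/
def IsPiecewiseZAffine {m : ℕ} (F : (Fin m → ℝ) → ℝ) : Prop :=
  ∃ C : Set (Set (Fin m → ℝ)), IsPolyhedralComplex C ∧ ⋃₀ C = univ ∧
    ∀ σ ∈ C, ∃ G, IsZAffineFunction G ∧ EqOn F G σ

/-- (Locally) piecewise `ℤ`-affine functions on an open rational polyhedral set `U`. -/
def IsPiecewiseZAffineOn {m : ℕ} (φ : (Fin m → ℝ) → ℝ) (U : Set (Fin m → ℝ)) : Prop :=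
  ∀ p ∈ U, ∃ F, IsPiecewiseZAffine F ∧ φ =ᶠ[𝓝[U] p] F

/-- Concave functions on an open rational polyhedral set `U` (a local notion): near each point `φ`
agrees with a function that is concave on a convex set containing a neighbourhood of the point
in `U`. -/
def IsLocallyConcaveOn {m : ℕ} (φ : (Fin m → ℝ) → ℝ) (U : Set (Fin m → ℝ)) : Prop :=
  ∀ p ∈ U, ∃ O : Set (Fin m → ℝ), IsOpen O ∧ p ∈ O ∧
    ∃ (K : Set (Fin m → ℝ)) (F : (Fin m → ℝ) → ℝ),
      O ∩ U ⊆ K ∧ EqOn φ F (O ∩ U) ∧ ConcaveOn ℝ K F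

/-- An integral `k × m` matrix is unimodular if it has rank `m` and `ℤ^k / A ℤ^m` is
torsion-free. -/
def IsUnimodularMatrix {m k : ℕ} (A : Matrix (Fin k) (Fin m) ℤ) : Prop :=
  A.rank = m ∧ Module.IsTorsionFree ℤ ((Fin k → ℤ) ⧸ LinearMap.range A.mulVecLin)

/-- Unimodular `ℤ`-affine maps. -/
def IsUnimodularZAffine {m k : ℕ} (F : (Fin m → ℝ) → (Fin k → ℝ)) : Prop :=
  ∃ (A : Matrix (Fin k) (Fin m) ℤ) (b : Fin k → ℝ), IsUnimodularMatrix A ∧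
    ∀ x, F x = (A.map (Int.cast : ℤ → ℝ)).mulVec x + b

/-- Unimodular maps on an open rational polyhedral set `U`. -/
def IsUnimodularOn {m k : ℕ} (φ : (Fin m → ℝ) → (Fin k → ℝ)) (U : Set (Fin m → ℝ)) : Prop :=
  ∃ C, IsRationalPolyhedralComplex C ∧ IsOpenInSupport C U ∧
    ∀ σ ∈ C, ∃ F, IsUnimodularZAffine F ∧ EqOn φ F (σ ∩ U)

theorem isRationalPolyhedralComplex_univ (m : ℕ) :
    IsRationalPolyhedralComplex ({univ} : Set (Set (Fin m → ℝ))) := by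
  have hu : (univ : Set (Fin m → ℝ)) = polyhedronOf ∅ := by ext x; simp [polyhedronOf]
  refine ⟨⟨?_, ?_, ?_, ?_⟩, ?_⟩
  · rintro σ rfl
    exact ⟨∅, hu⟩
  · exact locallyFinite_of_finite _
  · rintro σ rfl τ ⟨H, J, hJ, hH, rfl⟩ ⟨y, -, hy⟩
    refine eq_univ_of_forall fun x => ⟨mem_univ _, fun h hh => ?_⟩
    have hx : x ∈ polyhedronOf H := hH ▸ mem_univ x
    have hx' : (y + y - x) ∈ polyhedronOf H := hH ▸ mem_univ _
    have h1 := hx h (hJ hh)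
    have h2 := hx' h (hJ hh)
    have h3 := hy h hh
    simp only [dotProduct_sub, dotProduct_add] at h2
    linarith
  · rintro σ rfl σ' rfl -
    have : IsFace (univ ∩ univ : Set (Fin m → ℝ)) univ :=
      ⟨∅, ∅, subset_rfl, hu, by ext x; simp⟩
    exact ⟨this, this⟩
  · rintro σ rfl
    exact ⟨∅, by simp, hu⟩

theorem IsOpen.isOpenRationalPolyhedral {m : ℕ} {U : Set (Fin m → ℝ)} (hU : IsOpen U) :
    IsOpenRationalPolyhedral U :=
  ⟨{univ}, isRationalPolyhedralComplex_univ m, U, hU, by simp⟩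

/-! ### Rational polyhedral spaces -/

/-- A chart `α : X_i → U_i` of a rational polyhedral atlas: a homeomorphism from an open subset
of `X` (the source) onto an open rational polyhedral set in some `ℝ^dim` (the target). -/
structure RationalPolyhedralChart (X : Type*) [TopologicalSpace X] where
  dim : ℕ
  equiv : PartialEquiv X (Fin dim → ℝ)
  isOpen_source : IsOpen equiv.source
  target_isOpenRationalPolyhedral : IsOpenRationalPolyhedral equiv.target
  continuousOn_toFun : ContinuousOn equiv equiv.source
  continuousOn_symm : ContinuousOn equiv.symm equiv.target

/-- The image `α (X_i ∩ X_j)` of the overlap with the source of a second chart. -/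
def RationalPolyhedralChart.overlap {X : Type*} [TopologicalSpace X]
    (c c' : RationalPolyhedralChart X) : Set (Fin c.dim → ℝ) :=
  c.equiv '' (c.equiv.source ∩ c'.equiv.source)

/-- Rational polyhedral atlases: the charts cover, and all transition maps are tropical
morphisms. -/
structure IsRationalPolyhedralAtlas {X : Type*} [TopologicalSpace X]
    (A : Set (RationalPolyhedralChart X)) : Prop where
  cover : ∀ x : X, ∃ c ∈ A, x ∈ c.equiv.source
  compatible : ∀ c ∈ A, ∀ c' ∈ A,
    IsTropicalMorphismOn (c'.equiv ∘ c.equiv.symm) (c.overlap c')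

/-- A rational polyhedral space: a Hausdorff space with an equivalence class of rational
polyhedral atlases, given by a representative. -/
class RationalPolyhedralSpace (X : Type*) [TopologicalSpace X] extends T2Space X where
  atlas : Set (RationalPolyhedralChart X)
  isAtlas : IsRationalPolyhedralAtlas atlas

/-- `A` is an atlas of the rational polyhedral space `X`: an atlas equivalent to the given one. -/
def IsAtlasOf (X : Type*) [TopologicalSpace X] [RationalPolyhedralSpace X]
    (A : Set (RationalPolyhedralChart X)) : Prop :=
  IsRationalPolyhedralAtlas A ∧
    IsRationalPolyhedralAtlas (A ∪ RationalPolyhedralSpace.atlas)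

/-- A map `X → ℝ^k` is unimodular if it is so in the charts of some atlas of `X`. -/
def IsUnimodularMap {X : Type*} [TopologicalSpace X] [RationalPolyhedralSpace X] {k : ℕ}
    (ψ : X → (Fin k → ℝ)) : Prop :=
  ∃ A, IsAtlasOf X A ∧ ∀ c ∈ A, IsUnimodularOn (ψ ∘ c.equiv.symm) c.equiv.target

/-! ### The tropical semifield and tropical projective space -/

/-- `𝕋 = ℝ ∪ {+∞}`, with the order topology. -/
abbrev Trop : Type := WithTop ℝ

theorem Trop.continuous_coe : Continuous (fun r : ℝ => (r : Trop)) := by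
  have : (range (fun r : ℝ => (r : Trop))).OrdConnected := by
    refine ⟨?_⟩
    rintro _ ⟨a, rfl⟩ _ ⟨b, rfl⟩ z ⟨_, hz⟩
    induction z using WithTop.recTopCoe with
    | top => simp at hz
    | coe z => exact ⟨z, rfl⟩
  have hm : StrictMono (fun r : ℝ => (r : Trop)) := fun a b h => WithTop.coe_lt_coe.2 h
  exact (hm.isEmbedding_of_ordConnected this).continuous

theorem Trop.continuous_add_coe : Continuous (fun p : Trop × ℝ => p.1 + (p.2 : Trop)) := by
  have key : ∀ (a : Trop) (r c : ℝ), (a + (r : Trop) < (c : Trop) ↔ a < ((c - r : ℝ) : Trop)) ∧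
      ((c : Trop) < a + (r : Trop) ↔ ((c - r : ℝ) : Trop) < a) := by
    intro a r c
    induction a using WithTop.recTopCoe with
    | top => simpa using WithTop.coe_lt_top (c - r)
    | coe a =>
      rw [← WithTop.coe_add]
      simp only [WithTop.coe_lt_coe]
      constructor <;> constructor <;> intro h <;> linarith
  have hc : ∀ c : ℝ, Continuous (fun p : Trop × ℝ => ((c - p.2 : ℝ) : Trop)) := fun c =>
    Trop.continuous_coe.comp (continuous_const.sub continuous_snd)
  rw [OrderTopology.topology_eq_generate_intervals (α := Trop), continuous_generateFrom_iff]
  rintro s ⟨c, rfl | rfl⟩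
  · induction c using WithTop.recTopCoe with
    | top => simp
    | coe c =>
      have : (fun p : Trop × ℝ => p.1 + (p.2 : Trop)) ⁻¹' Ioi (c : Trop)
          = {p | ((c - p.2 : ℝ) : Trop) < p.1} := by
        ext p; exact (key p.1 p.2 c).2
      rw [this]
      exact isOpen_lt (hc c) continuous_fst
  · induction c using WithTop.recTopCoe with
    | top =>
      have : (fun p : Trop × ℝ => p.1 + (p.2 : Trop)) ⁻¹' Iio ⊤ = {p | p.1 < ⊤} := by
        ext p
        simp [WithTop.lt_top_iff_ne_top]
      rw [this]
      exact isOpen_lt continuous_fst continuous_const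
    | coe c =>
      have : (fun p : Trop × ℝ => p.1 + (p.2 : Trop)) ⁻¹' Iio (c : Trop)
          = {p | p.1 < ((c - p.2 : ℝ) : Trop)} := by
        ext p; exact (key p.1 p.2 c).1
      rw [this]
      exact isOpen_lt continuous_fst (hc c)

/-- Homogeneous coordinates: points of `𝕋^{k+1} ∖ {(+∞, …, +∞)}`. -/
abbrev TropVector (k : ℕ) : Type := {a : Fin (k + 1) → Trop // ∃ i, a i ≠ ⊤}

/-- Two vectors are identified if they differ by a real constant. -/
instance tropVectorSetoid (k : ℕ) : Setoid (TropVector k) where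
  r a b := ∃ c : ℝ, ∀ i, b.1 i = (c : Trop) + a.1 i
  iseqv :=
    { refl := fun a => ⟨0, fun i => by simp⟩
      symm := by
        rintro a b ⟨c, h⟩
        refine ⟨-c, fun i => ?_⟩
        rw [h i, ← add_assoc, ← WithTop.coe_add]
        simp
      trans := by
        rintro a b e ⟨c, h⟩ ⟨c', h'⟩
        refine ⟨c' + c, fun i => ?_⟩
        rw [h' i, h i, ← add_assoc, ← WithTop.coe_add] }

/-- The `k`-dimensional tropical projective space, with the quotient topology. -/
def TropProj (k : ℕ) : Type := Quotient (tropVectorSetoid k)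

instance (k : ℕ) : TopologicalSpace (TropProj k) :=
  inferInstanceAs (TopologicalSpace (Quotient (tropVectorSetoid k)))

/-- The class `(a_0 : ⋯ : a_k)`. -/
def TropProj.mk {k : ℕ} (a : TropVector k) : TropProj k := Quotient.mk _ a

/-- The identification `(a_1, …, a_k) ↦ (0 : a_1 : ⋯ : a_k)` of `ℝ^k` with the maximal tropical
torus of `TP^k`. -/
def TropProj.ofReal {k : ℕ} (a : Fin k → ℝ) : TropProj k :=
  TropProj.mk ⟨fun i => ((Fin.cons 0 a : Fin (k + 1) → ℝ) i : Trop), 0, WithTop.coe_ne_top⟩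

/-- A map `X → TP^k` is unimodular if it maps into the maximal tropical torus and is unimodular
as a map to `ℝ^k`. -/
def IsUnimodularToTropProj {X : Type*} [TopologicalSpace X] [RationalPolyhedralSpace X] {k : ℕ}
    (φ : X → TropProj k) : Prop :=
  ∃ ψ : X → (Fin k → ℝ), (∀ x, φ x = TropProj.ofReal (ψ x)) ∧ IsUnimodularMap ψ

/-- Faithful embeddings: unimodular and a homeomorphism onto the image. -/
def IsFaithfulEmbedding {X : Type*} [TopologicalSpace X] [RationalPolyhedralSpace X] {k : ℕ}
    (φ : X → TropProj k) : Prop :=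
  IsUnimodularToTropProj φ ∧ IsEmbedding φ

/-! ### Tropical line bundles -/

/-- A tropical line bundle on `X`: a space over `X` with an equivalence class of atlases, given by
a representative. A member `(α, β)` of the atlas is a chart `α` of `X` together with a
homeomorphism `β` from the preimage of its source `X_i` onto `X_i × 𝕋`, over `X_i`; the transitions
are `(α_j x, a) ↦ (α_i x, a + t (α_j x))` with tropical morphisms `t` to `ℝ`. -/
structure TropicalLineBundle (X : Type u) [TopologicalSpace X] [RationalPolyhedralSpace X] where
  Total : Type v
  [topologicalSpace : TopologicalSpace Total]
  proj : Total → X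
  continuous_proj : Continuous proj
  atlas : Set (RationalPolyhedralChart X × Trivialization Trop proj)
  isAtlasOf : IsAtlasOf X (Prod.fst '' atlas)
  baseSet_eq : ∀ p ∈ atlas, p.2.baseSet = p.1.equiv.source
  transition : ∀ p ∈ atlas, ∀ q ∈ atlas, ∃ t : (Fin p.1.dim → ℝ) → ℝ,
    IsTropicalFunctionOn t (p.1.overlap q.1) ∧
      ∀ x ∈ p.1.equiv.source ∩ q.1.equiv.source, ∀ a : Trop,
        p.2.coordChange q.2 x a = a + (t (p.1.equiv x) : Trop)

attribute [instance] TropicalLineBundle.topologicalSpace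

namespace TropicalLineBundle

section

variable {X : Type u} [TopologicalSpace X] [RationalPolyhedralSpace X]

theorem exists_mem_atlas (L : TropicalLineBundle X) (x : X) :
    ∃ p ∈ L.atlas, x ∈ p.1.equiv.source := by
  obtain ⟨_, ⟨p, hp, rfl⟩, hx⟩ := L.isAtlasOf.1.cover x
  exact ⟨p, hp, hx⟩

/-- Isomorphism of tropical line bundles: a homeomorphism over `X` that in all (equivalently,
in suitable) local trivializations has the form `(x, a) ↦ (x, a + t x)` with a tropical
morphism `t`. -/
def IsIsomorphic (L : TropicalLineBundle.{u, v} X) (L' : TropicalLineBundle.{u, w} X) : Prop :=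
  ∃ f : L.Total ≃ₜ L'.Total, (∀ z, L'.proj (f z) = L.proj z) ∧
    ∀ p ∈ L.atlas, ∀ q ∈ L'.atlas, ∃ t : (Fin p.1.dim → ℝ) → ℝ,
      IsTropicalFunctionOn t (p.1.overlap q.1) ∧
        ∀ x ∈ p.1.equiv.source ∩ q.1.equiv.source, ∀ a : Trop,
          q.2 (f (p.2.toOpenPartialHomeomorph.symm (x, a))) = (x, a + (t (p.1.equiv x) : Trop))

/-! #### Regular sections -/

/-- Global sections. -/
structure GlobalSection (L : TropicalLineBundle X) where
  toFun : X → L.Total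
  proj_toFun : ∀ x, L.proj (toFun x) = x

/-- The section is identically `+∞` in all local trivializations. -/
def GlobalSection.IsTrivial {L : TropicalLineBundle X} (s : L.GlobalSection) : Prop :=
  ∀ p ∈ L.atlas, ∀ y ∈ p.1.equiv.target, (p.2 (s.toFun (p.1.equiv.symm y))).2 = ⊤

/-- Regular sections: either `+∞`, or given in the charts by real-valued concave piecewise
`ℤ`-affine functions. -/
def GlobalSection.IsRegular {L : TropicalLineBundle X} (s : L.GlobalSection) : Prop :=
  s.IsTrivial ∨
    ∀ p ∈ L.atlas, ∃ φ : (Fin p.1.dim → ℝ) → ℝ,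
      (∀ y ∈ p.1.equiv.target, (p.2 (s.toFun (p.1.equiv.symm y))).2 = (φ y : Trop)) ∧
        IsLocallyConcaveOn φ p.1.equiv.target ∧ IsPiecewiseZAffineOn φ p.1.equiv.target

/-- The set `H⁰(X, L) ∖ {+∞}` of nontrivial regular global sections. -/
abbrev NontrivialRegularSection (L : TropicalLineBundle X) :=
  {s : L.GlobalSection // s.IsRegular ∧ ¬ s.IsTrivial}

/-- The value of a section at `x` in the local trivialization `p`. -/
def GlobalSection.value {L : TropicalLineBundle X} (s : L.GlobalSection)
    (p : RationalPolyhedralChart X × Trivialization Trop L.proj) (x : X) : Trop :=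
  (p.2 (s.toFun x)).2

theorem NontrivialRegularSection.value_ne_top {L : TropicalLineBundle X}
    (s : L.NontrivialRegularSection) {p} (hp : p ∈ L.atlas) {x : X} (hx : x ∈ p.1.equiv.source) :
    s.1.value p x ≠ ⊤ := by
  obtain ⟨φ, hφ, -⟩ := s.2.1.resolve_left s.2.2 p hp
  have := hφ (p.1.equiv x) (p.1.equiv.map_source hx)
  rw [p.1.equiv.left_inv hx] at this
  rw [GlobalSection.value, this]
  exact WithTop.coe_ne_top

/-- The map `x ↦ (s_0 x : ⋯ : s_k x)`, computed in any local trivialization at `x`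
(see `sectionMap_eq`). -/
noncomputable def sectionMap {L : TropicalLineBundle X} {k : ℕ}
    (s : Fin (k + 1) → L.NontrivialRegularSection) (x : X) : TropProj k :=
  TropProj.mk ⟨fun i => (s i).1.value (L.exists_mem_atlas x).choose x, 0,
    (s 0).value_ne_top (L.exists_mem_atlas x).choose_spec.1 (L.exists_mem_atlas x).choose_spec.2⟩

theorem sectionMap_eq {L : TropicalLineBundle X} {k : ℕ}
    (s : Fin (k + 1) → L.NontrivialRegularSection) {p} (hp : p ∈ L.atlas) {x : X}
    (hx : x ∈ p.1.equiv.source) :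
    sectionMap s x =
      TropProj.mk ⟨fun i => (s i).1.value p x, 0, (s 0).value_ne_top hp hx⟩ := by
  obtain ⟨hq, hxq⟩ := (L.exists_mem_atlas x).choose_spec
  obtain ⟨t, -, ht⟩ := L.transition _ hq p hp
  refine Quotient.sound ⟨t ((L.exists_mem_atlas x).choose.1.equiv x), fun i => ?_⟩
  have h := ht x ⟨hxq, hx⟩ ((s i).1.value (L.exists_mem_atlas x).choose x)
  have hpx := (s i).1.proj_toFun x
  have hb : L.proj ((s i).1.toFun x) ∈ (L.exists_mem_atlas x).choose.2.baseSet := by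
    rw [hpx, L.baseSet_eq _ hq]; exact hxq
  have h2 := Trivialization.coordChange_apply_snd _ p.2 hb
  rw [hpx] at h2
  exact (h2.symm.trans h).trans (add_comm _ _)

/-- `L` admits a faithful embedding of `X`: there are finitely many nontrivial regular global
sections `s_0, …, s_k` whose map to `TP^k` is a faithful embedding. -/
def AdmitsFaithfulEmbedding (L : TropicalLineBundle X) : Prop :=
  ∃ (k : ℕ) (s : Fin (k + 1) → L.NontrivialRegularSection), IsFaithfulEmbedding (sectionMap s)

/-! #### Multiples in the Picard group -/

/-- The transition function of `L` from `p` to `q`, as a function on `X` (meaningful on the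
common source). -/
noncomputable def transitionFun (L : TropicalLineBundle X) (p q : L.atlas) (x : X) : ℝ :=
  (p.1.2.coordChange q.1.2 x 0).untopD 0

theorem coordChange_eq (L : TropicalLineBundle X) (p q : L.atlas) {x : X}
    (hx : x ∈ p.1.1.equiv.source ∩ q.1.1.equiv.source) (a : Trop) :
    p.1.2.coordChange q.1.2 x a = a + (L.transitionFun p q x : Trop) := by
  obtain ⟨t, -, ht⟩ := L.transition _ p.2 _ q.2
  rw [transitionFun, ht x hx, ht x hx, zero_add]
  rfl

theorem exists_transitionFun_eq (L : TropicalLineBundle X) (p q : L.atlas) :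
    ∃ t : (Fin p.1.1.dim → ℝ) → ℝ, IsTropicalFunctionOn t (p.1.1.overlap q.1.1) ∧
      ∀ x ∈ p.1.1.equiv.source ∩ q.1.1.equiv.source,
        L.transitionFun p q x = t (p.1.1.equiv x) := by
  obtain ⟨t, h, ht⟩ := L.transition _ p.2 _ q.2
  refine ⟨t, h, fun x hx => ?_⟩
  rw [transitionFun, ht x hx, zero_add]
  rfl

theorem continuousOn_transitionFun (L : TropicalLineBundle X) (p q : L.atlas) :
    ContinuousOn (L.transitionFun p q) (p.1.1.equiv.source ∩ q.1.1.equiv.source) := by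
  obtain ⟨t, h, ht⟩ := L.exists_transitionFun_eq p q
  have h1 : ContinuousOn t (p.1.1.overlap q.1.1) := by
    intro y hy
    obtain ⟨F, ⟨a, b, hF⟩, hF'⟩ := h y hy
    have hc : Continuous F := by
      have : F = fun x => ∑ i, (a i : ℝ) * x i + b := funext hF
      rw [this]; fun_prop
    exact hc.continuousWithinAt.congr_of_eventuallyEq hF' (hF'.self_of_nhdsWithin hy)
  have h2 : ContinuousOn (t ∘ p.1.1.equiv) (p.1.1.equiv.source ∩ q.1.1.equiv.source) :=
    h1.comp (p.1.1.continuousOn_toFun.mono inter_subset_left) (mapsTo_image _ _)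
  exact h2.congr fun x hx => ht x hx

/-- The gluing data with transition functions `d • t_{ij}`. -/
noncomputable def multipleCore (L : TropicalLineBundle X) (d : ℕ) :
    FiberBundleCore L.atlas X Trop where
  baseSet p := p.1.1.equiv.source
  isOpen_baseSet p := p.1.1.isOpen_source
  indexAt x := ⟨(L.exists_mem_atlas x).choose, (L.exists_mem_atlas x).choose_spec.1⟩
  mem_baseSet_at x := (L.exists_mem_atlas x).choose_spec.2
  coordChange p q x a := a + ((d * L.transitionFun p q x : ℝ) : Trop)
  coordChange_self p x hx a := by
    have h := L.coordChange_eq p p ⟨hx, hx⟩ 0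
    rw [p.1.2.coordChange_same_apply (by rw [L.baseSet_eq _ p.2]; exact hx), zero_add] at h
    have : L.transitionFun p p x = 0 := (WithTop.coe_injective h).symm
    simp [this]
  continuousOn_coordChange p q := by
    refine Trop.continuous_add_coe.comp_continuousOn (continuousOn_snd.prodMk ?_)
    exact continuousOn_const.mul ((L.continuousOn_transitionFun p q).comp continuousOn_fst
      fun z hz => hz.1)
  coordChange_comp p q r x hx a := by
    obtain ⟨⟨hp, hq⟩, hr⟩ := hx
    have h := p.1.2.coordChange_coordChange q.1.2 r.1.2 (b := x)
      (by rw [L.baseSet_eq _ p.2]; exact hp) (by rw [L.baseSet_eq _ q.2]; exact hq) 0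
    rw [L.coordChange_eq p q ⟨hp, hq⟩, L.coordChange_eq q r ⟨hq, hr⟩,
      L.coordChange_eq p r ⟨hp, hr⟩, zero_add, zero_add, ← WithTop.coe_add] at h
    have h' := WithTop.coe_injective h
    rw [add_assoc, ← WithTop.coe_add, ← h', mul_add]

/-- The multiple `dL` in the tropical Picard group, represented by the line bundle glued from the
trivial bundles over the charts of `L` by means of the transition functions `d • t_{ij}`. -/
noncomputable def multiple (L : TropicalLineBundle.{u, v} X) (d : ℕ) :
    TropicalLineBundle.{u, u} X where
  Total := (L.multipleCore d).TotalSpace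
  proj := (L.multipleCore d).proj
  continuous_proj := (L.multipleCore d).continuous_proj
  atlas := range fun p : L.atlas => (p.1.1, (L.multipleCore d).localTriv p)
  isAtlasOf := by
    have : Prod.fst '' (range fun p : L.atlas => (p.1.1, (L.multipleCore d).localTriv p)) =
        Prod.fst '' L.atlas := by
      rw [← range_comp, image_eq_range]; rfl
    rw [this]
    exact L.isAtlasOf
  baseSet_eq := by
    rintro _ ⟨p, rfl⟩
    rfl
  transition := by
    rintro _ ⟨p, rfl⟩ _ ⟨q, rfl⟩
    obtain ⟨t, h, ht⟩ := L.exists_transitionFun_eq p q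
    refine ⟨fun y => d * t y, ?_, ?_⟩
    · intro y hy
      obtain ⟨F, ⟨a, b, hF⟩, hF'⟩ := h y hy
      refine ⟨fun x => d * F x, ⟨fun i => d * a i, d * b, fun x => ?_⟩, ?_⟩
      · simp only [hF, mul_add, Finset.mul_sum]
        push_cast
        simp only [mul_assoc]
      · filter_upwards [hF'] with x hx
        rw [hx]
    · intro x hx a
      change _ = a + ((d * t (p.1.1.equiv x) : ℝ) : Trop)
      rw [← ht x hx]
      change (((L.multipleCore d).localTriv q)
        (((L.multipleCore d).localTriv p).toOpenPartialHomeomorph.symm (x, a))).2 = _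
      rw [(L.multipleCore d).localTriv_symm_apply, (L.multipleCore d).localTriv_apply]
      exact (L.multipleCore d).coordChange_comp p _ q x
        ⟨⟨hx.1, (L.multipleCore d).mem_baseSet_at x⟩, hx.2⟩ a

end

end TropicalLineBundle

/-! ### Real tori with an integral structure

`V` is a finite-dimensional real vector space and `N`, `Λ` are lattices in `V`: `V = N_ℝ`, the
lattice `N` is the integral structure, and the torus is `V / Λ`. -/

section Torus

set_option linter.unusedSectionVars false

variable {V : Type u} [NormedAddCommGroup V] [NormedSpace ℝ V]

/-- The lattice `M = Hom (N, ℤ)`, realized as the group of all linear forms on `V = N_ℝ` with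
integral values on `N`; the canonical pairing `M × N_ℝ → ℝ` is evaluation. -/
def dualLattice (N : Submodule ℤ V) : AddSubgroup (V →ₗ[ℝ] ℝ) where
  carrier := {f | ∀ v ∈ N, ∃ k : ℤ, f v = k}
  zero_mem' := fun _ _ => ⟨0, by simp⟩
  add_mem' := by
    intro f g hf hg v hv
    obtain ⟨a, ha⟩ := hf v hv
    obtain ⟨b, hb⟩ := hg v hv
    exact ⟨a + b, by simp [ha, hb]⟩
  neg_mem' := by
    intro f hf v hv
    obtain ⟨a, ha⟩ := hf v hv
    exact ⟨-a, by simp [ha]⟩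

/-- The real torus `V / Λ` with the integral structure `N`. -/
@[nolint unusedArguments]
def RealTorus (_N Λ : Submodule ℤ V) : Type _ := V ⧸ Λ.toAddSubgroup

/-- The projection `V → V / Λ`. -/
def RealTorus.mk (N Λ : Submodule ℤ V) (v : V) : RealTorus N Λ :=
  QuotientAddGroup.mk (s := Λ.toAddSubgroup) v

instance (N Λ : Submodule ℤ V) : TopologicalSpace (RealTorus N Λ) :=
  inferInstanceAs (TopologicalSpace (V ⧸ Λ.toAddSubgroup))

instance (N Λ : Submodule ℤ V) [DiscreteTopology Λ] : T2Space (RealTorus N Λ) := by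
  have : IsClosed (Λ.toAddSubgroup : Set V) :=
    @AddSubgroup.isClosed_of_discrete _ _ _ _ _ Λ.toAddSubgroup ‹_›
  exact inferInstanceAs (T2Space (V ⧸ Λ.toAddSubgroup))

theorem RealTorus.mk_eq_mk {N Λ : Submodule ℤ V} {v w : V} :
    RealTorus.mk N Λ v = RealTorus.mk N Λ w ↔ w - v ∈ Λ := by
  refine (QuotientAddGroup.eq (s := Λ.toAddSubgroup)).trans ?_
  rw [neg_add_eq_sub]
  rfl

theorem RealTorus.continuous_mk (N Λ : Submodule ℤ V) : Continuous (RealTorus.mk N Λ) :=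
  continuous_quot_mk

theorem RealTorus.isOpenMap_mk (N Λ : Submodule ℤ V) : IsOpenMap (RealTorus.mk N Λ) :=
  QuotientAddGroup.isOpenMap_coe

/-- A continuous open map that is injective on an open set `W` is a homeomorphism from `W` onto
its image. -/
noncomputable def openInjHomeo {A B : Type*} [TopologicalSpace A] [TopologicalSpace B] [Nonempty A]
    (f : A → B) (hc : Continuous f) (ho : IsOpenMap f) (W : Set A) (hW : IsOpen W)
    (hi : InjOn f W) : OpenPartialHomeomorph A B :=
  OpenPartialHomeomorph.ofContinuousOpenRestrict (hi.toPartialEquiv f W) hc.continuousOn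
    (ho.domRestrict hW) hW

/-- The open subsets of `V` that inject into the torus. -/
abbrev TorusPatch (N Λ : Submodule ℤ V) : Type _ :=
  {W : Set V // IsOpen W ∧ InjOn (RealTorus.mk N Λ) W}

theorem exists_torusPatch (N Λ : Submodule ℤ V) [DiscreteTopology Λ] (v : V) :
    ∃ W : TorusPatch N Λ, v ∈ W.1 := by
  have h0 : IsOpen ({0} : Set Λ) := isOpen_discrete _
  obtain ⟨U, hU, hU0⟩ := isOpen_induced_iff.1 h0
  have h0U : (0 : V) ∈ U := by
    have : (0 : Λ) ∈ Subtype.val ⁻¹' U := by rw [hU0]; rfl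
    exact this
  obtain ⟨ε, hε, hb⟩ := Metric.isOpen_iff.1 hU 0 h0U
  refine ⟨⟨Metric.ball v (ε / 2), Metric.isOpen_ball, ?_⟩, Metric.mem_ball_self (half_pos hε)⟩
  intro a ha b hb' hab
  have hmem := RealTorus.mk_eq_mk.1 hab
  have hd : dist b a < ε := by
    have := dist_triangle_right b a v
    rw [Metric.mem_ball] at ha hb'
    linarith
  have : (⟨b - a, hmem⟩ : Λ) ∈ Subtype.val ⁻¹' U := hb (by
    rw [Metric.mem_ball, dist_zero_right, ← dist_eq_norm]; exact hd)
  rw [hU0] at this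
  have h := congrArg Subtype.val (mem_singleton_iff.1 this)
  exact (sub_eq_zero.1 h).symm

/-- The projection `V → V / Λ` as a homeomorphism from `W` onto its image. -/
noncomputable def torusHomeo (N Λ : Submodule ℤ V) (W : TorusPatch N Λ) :
    OpenPartialHomeomorph V (RealTorus N Λ) :=
  openInjHomeo (RealTorus.mk N Λ) (RealTorus.continuous_mk N Λ) (RealTorus.isOpenMap_mk N Λ)
    W.1 W.2.1 W.2.2

theorem torusHomeo_symm_mk (N Λ : Submodule ℤ V) (W : TorusPatch N Λ) {v : V} (hv : v ∈ W.1) :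
    (torusHomeo N Λ W).symm (RealTorus.mk N Λ v) = v :=
  (torusHomeo N Λ W).left_inv (x := v) hv

variable [FiniteDimensional ℝ V]

section

variable (N : Submodule ℤ V) [DiscreteTopology N] [IsZLattice ℝ N]

/-- A `ℤ`-basis of `N`, as an `ℝ`-basis of `V = N_ℝ`. -/
noncomputable def latticeBasis : Module.Basis (Fin (Module.finrank ℤ N)) ℝ V :=
  haveI : Module.Finite ℤ N := ZLattice.module_finite ℝ N
  haveI : Module.Free ℤ N := ZLattice.module_free ℝ N
  (Module.finBasis ℤ N).ofZLatticeBasis ℝ N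

theorem latticeBasis_mem (i : Fin (Module.finrank ℤ N)) : latticeBasis N i ∈ N := by
  have : Module.Finite ℤ N := ZLattice.module_finite ℝ N
  have : Module.Free ℤ N := ZLattice.module_free ℝ N
  rw [latticeBasis, Module.Basis.ofZLatticeBasis_apply]
  exact Subtype.property _

/-- The coordinates `V ≃ ℝ^n` given by a `ℤ`-basis of `N`. -/
noncomputable def latticeCoord : V ≃L[ℝ] (Fin (Module.finrank ℤ N) → ℝ) :=
  (latticeBasis N).equivFunL

end

variable (N Λ : Submodule ℤ V) [DiscreteTopology N] [IsZLattice ℝ N]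

/-- The chart of `V / Λ` given by the inverse of the projection `W → V / Λ`, in the coordinates of
a `ℤ`-basis of `N`. -/
noncomputable def torusChart (W : TorusPatch N Λ) : RationalPolyhedralChart (RealTorus N Λ) where
  dim := Module.finrank ℤ N
  equiv := ((torusHomeo N Λ W).symm.transHomeomorph
    (latticeCoord N).toHomeomorph).toPartialEquiv
  isOpen_source := OpenPartialHomeomorph.open_source _
  target_isOpenRationalPolyhedral :=
    (OpenPartialHomeomorph.open_target _).isOpenRationalPolyhedral
  continuousOn_toFun := OpenPartialHomeomorph.continuousOn _
  continuousOn_symm := OpenPartialHomeomorph.continuousOn_symm _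

theorem torusChart_mk (W : TorusPatch N Λ) {v : V} (hv : v ∈ W.1) :
    (torusChart N Λ W).equiv (RealTorus.mk N Λ v) = latticeCoord N v := by
  change latticeCoord N ((torusHomeo N Λ W).symm (RealTorus.mk N Λ v)) = _
  rw [torusHomeo_symm_mk N Λ W hv]

theorem torusChart_symm (W : TorusPatch N Λ) (y : Fin (Module.finrank ℤ N) → ℝ) :
    (torusChart N Λ W).equiv.symm y = RealTorus.mk N Λ ((latticeCoord N).symm y) := rfl

theorem torusChart_source (W : TorusPatch N Λ) :
    (torusChart N Λ W).equiv.source = RealTorus.mk N Λ '' W.1 := rfl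

/-- Over a point of the overlap the lifts to two patches differ by an element of `Λ`, and this
remains so nearby, with the same element. -/
theorem torus_overlap (W W' : TorusPatch N Λ) {p : Fin (Module.finrank ℤ N) → ℝ}
    (hp : p ∈ (torusChart N Λ W).overlap (torusChart N Λ W')) :
    ∃ u ∈ Λ, ∀ᶠ y in 𝓝 p, (torusHomeo N Λ W').symm
      (RealTorus.mk N Λ ((latticeCoord N).symm y)) = (latticeCoord N).symm y + u := by
  obtain ⟨x, ⟨hx, hx'⟩, rfl⟩ := hp
  rw [torusChart_source] at hx hx'
  obtain ⟨v, hv, rfl⟩ := hx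
  obtain ⟨w, hw, hwv⟩ := hx'
  rw [torusChart_mk N Λ W hv]
  refine ⟨w - v, RealTorus.mk_eq_mk.1 hwv.symm, ?_⟩
  have hc : Continuous fun y => (latticeCoord N).symm y + (w - v) := by fun_prop
  have : ∀ᶠ y in 𝓝 (latticeCoord N v), (latticeCoord N).symm y + (w - v) ∈ W'.1 := by
    refine hc.continuousAt.eventually (W'.2.1.mem_nhds ?_)
    simpa using hw
  filter_upwards [this] with y hy
  have h : RealTorus.mk N Λ ((latticeCoord N).symm y) =
      RealTorus.mk N Λ ((latticeCoord N).symm y + (w - v)) := by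
    rw [RealTorus.mk_eq_mk]
    simpa using RealTorus.mk_eq_mk.1 hwv.symm
  rw [h, torusHomeo_symm_mk N Λ W' hy]

theorem isZAffine_add_const {k : ℕ} (b : Fin k → ℝ) :
    IsZAffine (fun y : Fin k → ℝ => y + b) :=
  ⟨1, b, fun y => by rw [Matrix.map_one _ Int.cast_zero Int.cast_one, Matrix.one_mulVec]⟩

theorem isZAffineFunction_latticeCoord {N : Submodule ℤ V} [DiscreteTopology N] [IsZLattice ℝ N]
    (f : dualLattice N) (r : ℝ) :
    IsZAffineFunction (fun y => -f.1 ((latticeCoord N).symm y) - r) := by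
  choose a ha using fun i => f.2 (latticeBasis N i) (latticeBasis_mem N i)
  refine ⟨fun i => -a i, -r, fun y => ?_⟩
  have h : (latticeCoord N).symm y = ∑ i, y i • latticeBasis N i :=
    (latticeBasis N).equivFun_symm_apply y
  have h' : ∀ i, f.1 (y i • latticeBasis N i) = a i * y i := fun i => by
    rw [map_smul, ha, smul_eq_mul, mul_comm]
  simp only [h, map_sum, h', Int.cast_neg, neg_mul, Finset.sum_neg_distrib, sub_eq_add_neg]

theorem torus_isAtlas [DiscreteTopology Λ] :
    IsRationalPolyhedralAtlas (range (torusChart N Λ)) where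
  cover x := by
    obtain ⟨v, rfl⟩ := QuotientAddGroup.mk_surjective x
    obtain ⟨W, hW⟩ := exists_torusPatch N Λ v
    exact ⟨_, ⟨W, rfl⟩, v, hW, rfl⟩
  compatible := by
    rintro _ ⟨W, rfl⟩ _ ⟨W', rfl⟩ p hp
    obtain ⟨u, -, hu⟩ := torus_overlap N Λ W W' hp
    refine ⟨_, isZAffine_add_const (latticeCoord N u), ?_⟩
    · refine Filter.Eventually.filter_mono nhdsWithin_le_nhds ?_
      filter_upwards [hu] with y hy
      change latticeCoord N ((torusHomeo N Λ W').symm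
        (RealTorus.mk N Λ ((latticeCoord N).symm y))) = _
      rw [hy, map_add]
      exact congrArg (· + latticeCoord N u) ((latticeCoord N).apply_symm_apply y)

noncomputable instance [DiscreteTopology Λ] : RationalPolyhedralSpace (RealTorus N Λ) where
  atlas := range (torusChart N Λ)
  isAtlas := torus_isAtlas N Λ

end Torus

/-! ### Tropical descent data, polarizations, and the line bundles `L(λ, γ)` -/

section Descent

variable {V : Type u} [NormedAddCommGroup V] [NormedSpace ℝ V]

/-- A homomorphism `λ : Λ → M` is a polarization on `V / Λ` if `⟨λ(·), ·⟩` on `Λ × Λ` extends to a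
symmetric positive-definite bilinear form on `V`. -/
def IsPolarization {N Λ : Submodule ℤ V} (lam : Λ →+ dualLattice N) : Prop :=
  ∃ Q : V →ₗ[ℝ] V →ₗ[ℝ] ℝ, (∀ u v : Λ, Q u v = (lam u).1 v) ∧
    (∀ x y, Q x y = Q y x) ∧ ∀ x, x ≠ 0 → 0 < Q x x

/-- A tropical abelian variety is a real torus that has a polarization. -/
def IsTropicalAbelianVariety (N Λ : Submodule ℤ V) : Prop :=
  ∃ lam : Λ →+ dualLattice N, IsPolarization lam

/-- Tropical descent data `(λ, γ)`. -/
structure TropicalDescentDatum (N Λ : Submodule ℤ V) where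
  lam : Λ →+ dualLattice N
  gam : Λ → ℝ
  gam_add : ∀ u₁ u₂ : Λ, gam (u₁ + u₂) - gam u₁ - gam u₂ = (lam u₂).1 u₁

namespace TropicalDescentDatum

variable {N Λ : Submodule ℤ V} (D : TropicalDescentDatum N Λ)

/-- The action `u • (x, t) = (x + u, t - ⟨λ u, x⟩ - γ u)` of `Λ` on `V × 𝕋`. -/
noncomputable def act (u : Λ) (z : V × Trop) : V × Trop :=
  (z.1 + u, z.2 + ((-(D.lam u).1 z.1 - D.gam u : ℝ) : Trop))

theorem gam_zero : D.gam 0 = 0 := by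
  have h := D.gam_add 0 0
  simp at h
  exact h

theorem act_zero (z : V × Trop) : D.act 0 z = z := by
  simp [act, D.gam_zero]

theorem act_act (u v : Λ) (z : V × Trop) : D.act v (D.act u z) = D.act (u + v) z := by
  have h := D.gam_add u v
  ext
  · simp [act, add_assoc]
  · simp only [act]
    rw [add_assoc, ← WithTop.coe_add]
    congr 2
    simp only [map_add, AddSubgroup.coe_add, LinearMap.add_apply]
    linarith

/-- Two points of `V × 𝕋` are equivalent if they lie in the same `Λ`-orbit. -/
def orbitSetoid : Setoid (V × Trop) where
  r z w := ∃ u : Λ, w = D.act u z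
  iseqv :=
    { refl := fun z => ⟨0, (D.act_zero z).symm⟩
      symm := by
        rintro z _ ⟨u, rfl⟩
        exact ⟨-u, by rw [act_act, add_neg_cancel, act_zero]⟩
      trans := by
        rintro z _ _ ⟨u, rfl⟩ ⟨v, rfl⟩
        exact ⟨u + v, D.act_act u v z⟩ }

/-- The total space `(V × 𝕋) / Λ` of `L(λ, γ)`, with the quotient topology. -/
def Total : Type _ := Quotient D.orbitSetoid

instance : TopologicalSpace D.Total := inferInstanceAs (TopologicalSpace (Quotient D.orbitSetoid))

/-- The quotient map `V × 𝕋 → L(λ, γ)`. -/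
def toTotal (z : V × Trop) : D.Total := Quotient.mk D.orbitSetoid z

/-- The projection `L(λ, γ) → V / Λ`. -/
def proj : D.Total → RealTorus N Λ :=
  Quotient.lift (fun z => RealTorus.mk N Λ z.1) (by
    rintro z _ ⟨u, rfl⟩
    rw [RealTorus.mk_eq_mk]
    simp [act])

theorem continuous_toTotal : Continuous D.toTotal := continuous_quot_mk

theorem continuous_proj : Continuous D.proj :=
  continuous_quot_lift _ ((RealTorus.continuous_mk N Λ).comp continuous_fst)

theorem proj_toTotal (z : V × Trop) : D.proj (D.toTotal z) = RealTorus.mk N Λ z.1 := rfl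

theorem toTotal_eq {z w : V × Trop} : D.toTotal z = D.toTotal w ↔ ∃ u : Λ, w = D.act u z :=
  Quotient.eq (r := D.orbitSetoid)

theorem continuous_act [FiniteDimensional ℝ V] (u : Λ) : Continuous (D.act u) := by
  have h : Continuous (D.lam u).1 := LinearMap.continuous_of_finiteDimensional _
  refine (continuous_fst.add continuous_const).prodMk ?_
  refine Trop.continuous_add_coe.comp (continuous_snd.prodMk ?_)
  exact ((h.comp continuous_fst).neg).sub continuous_const

theorem isOpenMap_toTotal [FiniteDimensional ℝ V] : IsOpenMap D.toTotal := by
  intro U hU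
  change IsOpen (D.toTotal ⁻¹' (D.toTotal '' U))
  have : D.toTotal ⁻¹' (D.toTotal '' U) = ⋃ u : Λ, D.act u ⁻¹' U := by
    ext z
    simp only [mem_preimage, mem_image, mem_iUnion]
    constructor
    · rintro ⟨w, hw, hwz⟩
      obtain ⟨u, rfl⟩ := D.toTotal_eq.1 hwz.symm
      exact ⟨u, hw⟩
    · rintro ⟨u, hu⟩
      exact ⟨_, hu, (D.toTotal_eq.2 ⟨u, rfl⟩).symm⟩
  rw [this]
  exact isOpen_iUnion fun u => hU.preimage (D.continuous_act u)

theorem injOn_toTotal (W : TorusPatch N Λ) : InjOn D.toTotal (W.1 ×ˢ univ) := by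
  rintro z ⟨hz, -⟩ w ⟨hw, -⟩ h
  obtain ⟨u, rfl⟩ := D.toTotal_eq.1 h
  have h1 : z.1 = z.1 + u := W.2.2 hz hw (by rw [RealTorus.mk_eq_mk]; simp)
  have h2 : u = 0 := Subtype.ext (by simpa using h1)
  rw [h2, act_zero]

variable [FiniteDimensional ℝ V]

/-- The quotient map as a homeomorphism from `W × 𝕋` onto its image. -/
noncomputable def totalHomeo (W : TorusPatch N Λ) : OpenPartialHomeomorph (V × Trop) D.Total :=
  openInjHomeo D.toTotal D.continuous_toTotal D.isOpenMap_toTotal (W.1 ×ˢ univ)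
    (W.2.1.prod isOpen_univ) (D.injOn_toTotal W)

/-- The local trivialization `[(x, t)] ↦ (x mod Λ, t)`, for `x ∈ W`. -/
noncomputable def triv (W : TorusPatch N Λ) : Trivialization Trop D.proj where
  toOpenPartialHomeomorph := (D.totalHomeo W).symm.trans'
    ((torusHomeo N Λ W).prod (OpenPartialHomeomorph.refl Trop)) rfl
  baseSet := RealTorus.mk N Λ '' W.1
  open_baseSet := RealTorus.isOpenMap_mk N Λ _ W.2.1
  source_eq := by
    change D.toTotal '' (W.1 ×ˢ univ) = _
    ext z
    obtain ⟨z, rfl⟩ : ∃ y, D.toTotal y = z := Quotient.exists_rep z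
    constructor
    · rintro ⟨w, hw, hwz⟩
      rw [mem_preimage, ← hwz]
      exact ⟨w.1, hw.1, rfl⟩
    · rintro ⟨v, hv, hvz⟩
      have h := RealTorus.mk_eq_mk.1 (hvz.symm : RealTorus.mk N Λ z.1 = RealTorus.mk N Λ v)
      refine ⟨D.act ⟨_, h⟩ z, ⟨?_, mem_univ _⟩, (D.toTotal_eq.2 ⟨_, rfl⟩).symm⟩
      simpa [act] using hv
  target_eq := by
    rfl
  proj_toFun := by
    rintro _ ⟨w, hw, rfl⟩
    change (torusHomeo N Λ W) ((D.totalHomeo W).symm (D.totalHomeo W w)).1 = _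
    rw [(D.totalHomeo W).left_inv hw]
    rfl

theorem triv_toTotal (W : TorusPatch N Λ) {v : V} (hv : v ∈ W.1) (a : Trop) :
    D.triv W (D.toTotal (v, a)) = (RealTorus.mk N Λ v, a) := by
  change ((torusHomeo N Λ W).prod (OpenPartialHomeomorph.refl Trop))
    ((D.totalHomeo W).symm (D.totalHomeo W (v, a))) = _
  rw [(D.totalHomeo W).left_inv ⟨hv, mem_univ _⟩]
  rfl

theorem triv_symm (W : TorusPatch N Λ) {v : V} (hv : v ∈ W.1) (a : Trop) :
    (D.triv W).toOpenPartialHomeomorph.symm (RealTorus.mk N Λ v, a) = D.toTotal (v, a) := by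
  change D.toTotal ((torusHomeo N Λ W).symm (RealTorus.mk N Λ v), a) = _
  rw [torusHomeo_symm_mk N Λ W hv]

variable [DiscreteTopology N] [IsZLattice ℝ N] [DiscreteTopology Λ]

open Classical in
/-- The tropical line bundle `L(λ, γ) = (V × 𝕋) / Λ` on `V / Λ`. -/
noncomputable def lineBundle : TropicalLineBundle.{u, u} (RealTorus N Λ) where
  Total := D.Total
  proj := D.proj
  continuous_proj := D.continuous_proj
  atlas := range fun W : TorusPatch N Λ => (torusChart N Λ W, D.triv W)
  isAtlasOf := by
    have : Prod.fst '' (range fun W : TorusPatch N Λ => (torusChart N Λ W, D.triv W)) =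
        range (torusChart N Λ) := by
      rw [← range_comp]; rfl
    rw [this]
    refine ⟨torus_isAtlas N Λ, ?_⟩
    change IsRationalPolyhedralAtlas (range (torusChart N Λ) ∪ range (torusChart N Λ))
    rw [union_self]
    exact torus_isAtlas N Λ
  baseSet_eq := by
    rintro _ ⟨W, rfl⟩
    rfl
  transition := by
    rintro _ ⟨W, rfl⟩ _ ⟨W', rfl⟩
    refine ⟨fun y =>
      if h : (torusHomeo N Λ W').symm (RealTorus.mk N Λ ((latticeCoord N).symm y)) -
          (latticeCoord N).symm y ∈ Λ then
        -(D.lam ⟨_, h⟩).1 ((latticeCoord N).symm y) - D.gam ⟨_, h⟩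
      else 0, ?_, ?_⟩
    · intro p hp
      obtain ⟨u, hu, hu'⟩ := torus_overlap N Λ W W' hp
      refine ⟨_, isZAffineFunction_latticeCoord (N := N) (D.lam ⟨u, hu⟩) (D.gam ⟨u, hu⟩), ?_⟩
      · refine Filter.Eventually.filter_mono nhdsWithin_le_nhds ?_
        filter_upwards [hu'] with y hy
        have h1 : (torusHomeo N Λ W').symm (RealTorus.mk N Λ ((latticeCoord N).symm y)) -
          (latticeCoord N).symm y = u := by rw [hy, add_sub_cancel_left]
        have h2 : (torusHomeo N Λ W').symm (RealTorus.mk N Λ ((latticeCoord N).symm y)) -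
          (latticeCoord N).symm y ∈ Λ := h1 ▸ hu
        rw [dif_pos h2]
        have h3 : (⟨_, h2⟩ : Λ) = ⟨u, hu⟩ := Subtype.ext h1
        rw [h3]
    · rintro _ ⟨⟨v, hv, rfl⟩, ⟨w, hw, hwv⟩⟩ a
      have h1 : (torusHomeo N Λ W').symm (RealTorus.mk N Λ v) = w := by
        rw [← hwv]; exact torusHomeo_symm_mk N Λ W' hw
      have h2 : w - v ∈ Λ := RealTorus.mk_eq_mk.1 hwv.symm
      change ((D.triv W') ((D.triv W).toOpenPartialHomeomorph.symm (RealTorus.mk N Λ v, a))).2 = _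
      rw [D.triv_symm W hv]
      have h3 : D.toTotal (v, a) = D.toTotal (D.act ⟨_, h2⟩ (v, a)) :=
        D.toTotal_eq.2 ⟨_, rfl⟩
      have h4 : D.act ⟨_, h2⟩ (v, a) =
          (w, a + ((-(D.lam ⟨_, h2⟩).1 v - D.gam ⟨_, h2⟩ : ℝ) : Trop)) := by
        simp [act]
      rw [h3, h4, D.triv_toTotal W' hw, torusChart_mk N Λ W hv]
      simp only [ContinuousLinearEquiv.symm_apply_apply, h1]
      rw [dif_pos h2]

end TropicalDescentDatum

/-- A tropical line bundle on the torus is positive if it is isomorphic to `L(λ, γ)` for a tropical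
descent datum `(λ, γ)` such that `λ` is a polarization. -/
def TropicalLineBundle.IsPositive [FiniteDimensional ℝ V] {N Λ : Submodule ℤ V}
    [DiscreteTopology N] [IsZLattice ℝ N] [DiscreteTopology Λ]
    (L : TropicalLineBundle.{u, v} (RealTorus N Λ)) : Prop :=
  ∃ D : TropicalDescentDatum N Λ, IsPolarization D.lam ∧ L.IsIsomorphic D.lineBundle

end Descent

/-! Let `Q` be the positive-definite form extending `⟨λ(·), ·⟩` and `q(x) = Q(x, x) / 2`. As `γ - q`
is additive on `Λ` and `Q` is nondegenerate, `γ(u) = q(u) + Q(e, u)` for some `e`. Sections of `dL`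
come from functions on `V` that are locally minima of finitely many integral affine forms and
transform under `Λ` by `-dλ(u) - dγ(u)`. Each `w` with `d Q(w, ·) ∈ M` yields one, `θ_w(x) = min_u
(d Q(w + u, x) + d q(w + u + e))`. Completing the square turns it into `d (min_u q(x + e + w + u) -
q(x) - Q(e, x))`. Only the first term depends on `w`, so differences of theta functions are governed
by the minima of `q` on cosets of `Λ`. The vectors `w` used represent all classes of `d⁻¹Λ / Λ`; to
them are added those for which the forms `d Q(w, ·)` are the basis dual to that of `N`.

Injectivity (`sub_mem_of_latMin_sub_eq`, `d ≥ 3`) is a tropical version of Lefschetz's argument: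
products of translates `ϑ(x + a) ϑ(x + b) ϑ(x - a - b) ϑ(x)^(d-3)` are sections of degree `d`. If
the degree `d` theta functions agree at two points up to a constant, the difference of the two
translated minima is therefore additive in the translation. Being bounded above it vanishes, and the
zeros of the minimum, which are exactly `Λ`, identify the points.

Unimodularity (`exists_minimizers_generate`, `d ≥ 2`) asks that at each point the slopes `d Q(w_r +
u_r, ·)` of suitable minimizing forms have differences generating `M`. After a small generic move
all minimizers are unique. The convexity of the Voronoi cell of `Λ` then exhibits `v / d`, for every
`v` shortest modulo `2Λ`, as a difference of two minimizers (`mem_of_unique_minimizers`). Such `v`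
generate `Λ`, so the differences generate a group containing every `w_r`, in particular the vectors
that give the dual basis. The arrangement of differences of forms supplies the polyhedral complex,
and compactness of the torus turns continuity and injectivity into an embedding. -/

/-! ### Integral affine forms and their arrangements -/

/-- The function `x ↦ ⟨a, x⟩ + b` attached to a pair `(a, b)`. -/
def affEval {m : ℕ} (h : (Fin m → ℤ) × ℝ) (x : Fin m → ℝ) : ℝ := ∑ i, (h.1 i : ℝ) * x i + h.2

theorem affEval_combo {m : ℕ} (h : (Fin m → ℤ) × ℝ) (x y : Fin m → ℝ) {a b : ℝ} (hab : a + b = 1) :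
    affEval h (a • x + b • y) = a * affEval h x + b * affEval h y := by
  have h1 : ∑ i, (h.1 i : ℝ) * (a • x + b • y) i =
      a * ∑ i, (h.1 i : ℝ) * x i + b * ∑ i, (h.1 i : ℝ) * y i := by
    rw [Finset.mul_sum, Finset.mul_sum, ← Finset.sum_add_distrib]
    refine Finset.sum_congr rfl fun i _ => ?_
    simp only [Pi.add_apply, Pi.smul_apply, smul_eq_mul]
    ring
  rw [affEval, h1, affEval, affEval]
  linear_combination -h.2 * hab

theorem affEval_sub {m : ℕ} (h h' : (Fin m → ℤ) × ℝ) (x : Fin m → ℝ) :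
    affEval (h - h') x = affEval h x - affEval h' x := by
  simp only [affEval, Prod.fst_sub, Prod.snd_sub, Pi.sub_apply, Int.cast_sub, sub_mul,
    Finset.sum_sub_distrib]
  ring

theorem isZAffineFunction_affEval {m : ℕ} (h : (Fin m → ℤ) × ℝ) : IsZAffineFunction (affEval h) :=
  ⟨h.1, h.2, fun _ => rfl⟩

section Arrangement

variable {m : ℕ} {κ : Type*} (h : κ → (Fin m → ℤ) × ℝ)

/-- The polyhedron on which the forms indexed by `P` are nonnegative. -/
def arrCell (P : Set κ) : Set (Fin m → ℝ) := {x | ∀ k ∈ P, 0 ≤ affEval (h k) x}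

/-- The forms that are nonnegative at `x`. -/
def arrPos (x : Fin m → ℝ) : Set κ := {k | 0 ≤ affEval (h k) x}

/-- The cells of the arrangement of the forms `h`, for an index set with an involution `neg` that
changes the signs of the forms. -/
def arrCells (neg : κ → κ) : Set (Set (Fin m → ℝ)) :=
  {σ | ∃ P : Set κ, (∀ k, k ∈ P ∨ neg k ∈ P) ∧ σ = arrCell h P}

theorem mem_arrCell_arrPos (x : Fin m → ℝ) : x ∈ arrCell h (arrPos h x) := fun _ hk => hk

theorem convex_arrCell (P : Set κ) : Convex ℝ (arrCell h P) := by
  intro x hx y hy a b ha hb hab k hk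
  rw [affEval_combo _ _ _ hab]
  have := hx k hk
  have := hy k hk
  positivity

/-- The forms `h k` for `k ∈ P` as a finite system of inequalities. -/
noncomputable def arrSystem [Finite κ] (P : Set κ) : Finset ((Fin m → ℝ) × ℝ) :=
  ((toFinite P).image fun k => ((fun i => ((h k).1 i : ℝ)), -(h k).2)).toFinset

theorem mem_arrSystem [Finite κ] {P : Set κ} {g : (Fin m → ℝ) × ℝ} :
    g ∈ arrSystem h P ↔ ∃ k ∈ P, ((fun i => ((h k).1 i : ℝ)), -(h k).2) = g := by
  simp [arrSystem]

theorem arrCell_eq_polyhedronOf [Finite κ] (P : Set κ) :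
    arrCell h P = polyhedronOf (arrSystem h P) := by
  ext x
  simp only [arrCell, polyhedronOf, mem_ofPred_eq, mem_arrSystem, forall_exists_index, and_imp,
    forall_apply_eq_imp_iff₂, affEval, dotProduct]
  refine forall₂_congr fun k _ => ?_
  constructor <;> intro h <;> linarith

variable {h} {neg : κ → κ}

theorem arrPos_total (hneg : ∀ k x, affEval (h (neg k)) x = -affEval (h k) x) (x : Fin m → ℝ)
    (k : κ) : k ∈ arrPos h x ∨ neg k ∈ arrPos h x := by
  simp only [arrPos, mem_ofPred_eq, hneg]
  rcases le_total 0 (affEval (h k) x) with h | h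
  · exact Or.inl h
  · exact Or.inr (by linarith)

/-- A convex subset of a cell is contained in the cell of one of its points. -/
theorem exists_subset_arrCell_arrPos [Finite κ]
    (hneg : ∀ k x, affEval (h (neg k)) x = -affEval (h k) x) {P : Set κ}
    (hP : ∀ k, k ∈ P ∨ neg k ∈ P) {T : Set (Fin m → ℝ)} (hT : Convex ℝ T) (hne : T.Nonempty)
    (hTP : T ⊆ arrCell h P) : ∃ x ∈ T, T ⊆ arrCell h (arrPos h x) := by
  -- A point of `T` with as few nonnegative forms as possible is as interior as `T` permits. Since
  -- no form changes sign on `T`, a form nonnegative at a midpoint is nonnegative at both ends; by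
  -- minimality at `x`, the midpoint of `x` and `y` loses none of the forms of `x`.
  obtain ⟨x, hx, hmin⟩ := WellFounded.has_min
    (InvImage.wf (fun x : Fin m → ℝ => (arrPos h x).ncard) (Nat.lt_wfRel.wf)) T hne
  refine ⟨x, hx, fun y hy => ?_⟩
  have hz : (1 / 2 : ℝ) • x + (1 / 2 : ℝ) • y ∈ T :=
    hT hx hy (by norm_num) (by norm_num) (by norm_num)
  set z := (1 / 2 : ℝ) • x + (1 / 2 : ℝ) • y with hzdef
  have hev : ∀ k, affEval (h k) z = 1 / 2 * affEval (h k) x + 1 / 2 * affEval (h k) y := fun k =>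
    affEval_combo _ _ _ (by norm_num)
  have key : arrPos h z ⊆ arrPos h x ∩ arrPos h y := by
    intro k hk
    have hk : 0 ≤ affEval (h k) z := hk
    rw [hev] at hk
    rcases hP k with hkP | hkP
    · exact ⟨hTP hx k hkP, hTP hy k hkP⟩
    · have h1 := hTP hx _ hkP
      have h2 := hTP hy _ hkP
      rw [hneg] at h1 h2
      simp only [arrPos, mem_inter_iff, mem_ofPred_eq]
      constructor <;> linarith
  have heq : arrPos h z = arrPos h x :=
    eq_of_subset_of_ncard_le (key.trans inter_subset_left) (not_lt.1 (hmin z hz)) (toFinite _)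
  intro k hk
  exact (key (heq ▸ hk)).2

/-- The inequalities to turn into equalities are those of `P` that are negatives of forms in `P'`:
they vanish on the intersection. Conversely, as `P` contains each form or its negative, a form of
`P'` outside `P` has its negative among them. -/
theorem isFace_arrCell_inter [Finite κ]
    (hneg : ∀ k x, affEval (h (neg k)) x = -affEval (h k) x) {P P' : Set κ}
    (hP : ∀ k, k ∈ P ∨ neg k ∈ P) :
    IsFace (arrCell h P ∩ arrCell h P') (arrCell h P) := by
  refine ⟨arrSystem h P, arrSystem h {k | k ∈ P ∧ ∃ k' ∈ P', neg k' = k}, ?_, arrCell_eq_polyhedronOf h P, ?_⟩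
  · intro g hg
    rw [mem_arrSystem] at hg ⊢
    obtain ⟨k, hk, rfl⟩ := hg
    exact ⟨k, hk.1, rfl⟩
  · ext x
    simp only [mem_inter_iff, mem_ofPred_eq, mem_arrSystem, forall_exists_index, and_imp]
    have hev : ∀ k, (fun i => ((h k).1 i : ℝ)) ⬝ᵥ x = affEval (h k) x - (h k).2 := fun k => by
      simp [affEval, dotProduct]
    refine and_congr_right fun hx => ⟨?_, ?_⟩
    · rintro hx' _ _ hk k hk' rfl rfl
      have h1 := hx _ hk
      have h2 := hx' _ hk'
      rw [hneg] at h1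
      rw [hev, hneg]
      linarith
    · intro H k hk
      rcases hP k with hkP | hkP
      · exact hx k hkP
      · have := H _ _ hkP k hk rfl rfl
        rw [hev, hneg] at this
        linarith

/-- A face may come from any finite system describing the cell, not only from the forms `h`. So `x`
is taken in the relative interior sense of `exists_subset_arrCell_arrPos`. The segment from a point
`y` of `arrCell h (arrPos h x)` to `x` extends slightly beyond `x` within the big cell, and an
inequality tight at `x` must then be tight at `y`. -/
theorem eq_arrCell_of_isFace [Finite κ]
    (hneg : ∀ k x, affEval (h (neg k)) x = -affEval (h k) x) {P : Set κ}
    (hP : ∀ k, k ∈ P ∨ neg k ∈ P) {τ : Set (Fin m → ℝ)} (hτ : IsFace τ (arrCell h P))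
    (hne : τ.Nonempty) : ∃ x, τ = arrCell h (arrPos h x) := by
  obtain ⟨H, J, hJ, hH, rfl⟩ := hτ
  have hconv : Convex ℝ {x | x ∈ arrCell h P ∧ ∀ g ∈ J, g.1 ⬝ᵥ x = g.2} := by
    rintro x ⟨hx, hx'⟩ y ⟨hy, hy'⟩ a b ha hb hab
    refine ⟨convex_arrCell h P hx hy ha hb hab, fun g hg => ?_⟩
    rw [dotProduct_add, dotProduct_smul, dotProduct_smul, hx' g hg, hy' g hg, ← add_smul, hab,
      one_smul]
  obtain ⟨x, ⟨hxP, hxJ⟩, hsub⟩ := exists_subset_arrCell_arrPos hneg hP hconv hne fun y hy => hy.1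
  refine ⟨x, hsub.antisymm fun y hy => ?_⟩
  have hyP : y ∈ arrCell h P := fun k hk => hy k (hxP k hk)
  refine ⟨hyP, fun g hg => ?_⟩
  have hev : ∀ k (t : ℝ), affEval (h k) (x + t • (x - y)) =
      affEval (h k) x + t * (affEval (h k) x - affEval (h k) y) := fun k t => by
    have := affEval_combo (h k) x y (a := 1 + t) (b := -t) (by ring)
    rw [show x + t • (x - y) = (1 + t) • x + (-t) • y by module, this]
    ring
  have hev2 : ∀ᶠ t : ℝ in 𝓝[>] 0, ∀ k : κ, k ∈ P → 0 ≤ affEval (h k) (x + t • (x - y)) := by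
    refine eventually_all.2 fun k => ?_
    by_cases hk : k ∈ P
    swap
    · exact Eventually.of_forall fun t hk' => absurd hk' hk
    simp only [hev]
    rcases (hxP k hk).lt_or_eq with h0 | h0
    · have : ContinuousAt (fun t : ℝ => affEval (h k) x + t * (affEval (h k) x - affEval (h k) y)) 0 :=
        by fun_prop
      have h1 := this.eventually (lt_mem_nhds (by simpa using h0))
      exact (h1.filter_mono nhdsWithin_le_nhds).mono fun t ht _ => ht.le
    -- A form that vanishes at `x` has its negative in `arrPos h x` too, so it also vanishes at `y`
    -- and is constant along the line.
    · have h2 : neg k ∈ arrPos h x := by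
        simp only [arrPos, mem_ofPred_eq, hneg, ← h0, neg_zero, le_refl]
      have h3 := hy _ h2
      have h4 := hyP k hk
      rw [hneg] at h3
      have h5 : affEval (h k) y = 0 := by linarith
      exact Eventually.of_forall fun t _ => by rw [← h0, h5]; simp
  obtain ⟨t, ht, ht0⟩ := (hev2.and self_mem_nhdsWithin).exists
  have ht0 : 0 < t := ht0
  have hz : x + t • (x - y) ∈ arrCell h P := ht
  rw [hH] at hz hyP
  have h1 := hz g (hJ hg)
  have h2 := hyP g (hJ hg)
  rw [dotProduct_add, dotProduct_smul, dotProduct_sub, hxJ g hg, smul_eq_mul] at h1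
  nlinarith

theorem isRationalPolyhedralComplex_arrCells [Finite κ]
    (hneg : ∀ k x, affEval (h (neg k)) x = -affEval (h k) x) :
    IsRationalPolyhedralComplex (arrCells h neg) := by
  refine ⟨⟨?_, ?_, ?_, ?_⟩, ?_⟩
  · rintro _ ⟨P, hP, rfl⟩
    exact ⟨_, arrCell_eq_polyhedronOf h P⟩
  · have : (arrCells h neg).Finite := by
      refine (finite_range (arrCell h)).subset ?_
      rintro _ ⟨P, hP, rfl⟩
      exact ⟨P, rfl⟩
    have := this.to_subtype
    exact locallyFinite_of_finite _
  · rintro _ ⟨P, hP, rfl⟩ τ hτ hne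
    obtain ⟨x, rfl⟩ := eq_arrCell_of_isFace hneg hP hτ hne
    exact ⟨_, arrPos_total hneg x, rfl⟩
  · rintro _ ⟨P, hP, rfl⟩ _ ⟨P', hP', rfl⟩ -
    refine ⟨isFace_arrCell_inter hneg hP, ?_⟩
    rw [inter_comm]
    exact isFace_arrCell_inter hneg hP'
  · rintro _ ⟨P, hP, rfl⟩
    refine ⟨_, ?_, arrCell_eq_polyhedronOf h P⟩
    intro g hg
    obtain ⟨k, -, rfl⟩ := (mem_arrSystem h).1 hg
    exact ⟨(h k).1, fun i => rfl⟩

theorem sUnion_arrCells (hneg : ∀ k x, affEval (h (neg k)) x = -affEval (h k) x) :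
    ⋃₀ arrCells h neg = univ :=
  eq_univ_of_forall fun x =>
    ⟨_, ⟨_, arrPos_total hneg x, rfl⟩, mem_arrCell_arrPos h x⟩

end Arrangement

/-! ### Minima of finitely many integral affine forms -/

section Min

variable {m : ℕ} {S ι : Type*}

/-- The differences of the forms in each of the families `G s`. -/
def formDiff (G : S → ι → (Fin m → ℤ) × ℝ) (k : S × ι × ι) : (Fin m → ℤ) × ℝ :=
  G k.1 k.2.1 - G k.1 k.2.2

theorem affEval_formDiff_swap (G : S → ι → (Fin m → ℤ) × ℝ) (k : S × ι × ι) (x : Fin m → ℝ) :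
    affEval (formDiff G (k.1, k.2.swap)) x = -affEval (formDiff G k) x := by
  simp only [formDiff, affEval_sub, Prod.fst_swap, Prod.snd_swap, neg_sub]

theorem mem_arrPos_formDiff {G : S → ι → (Fin m → ℤ) × ℝ} {s : S} {i j : ι} {x : Fin m → ℝ} :
    (s, i, j) ∈ arrPos (formDiff G) x ↔ affEval (G s j) x ≤ affEval (G s i) x := by
  simp only [arrPos, formDiff, mem_ofPred_eq, affEval_sub, sub_nonneg]

/-- `F` is on `U` the minimum of the forms `g i`. -/
def IsMinOfForms (g : ι → (Fin m → ℤ) × ℝ) (F : (Fin m → ℝ) → ℝ) (U : Set (Fin m → ℝ)) : Prop :=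
  ∀ x ∈ U, (∀ i, F x ≤ affEval (g i) x) ∧ ∃ i, F x = affEval (g i) x

theorem IsMinOfForms.concaveOn {g : ι → (Fin m → ℤ) × ℝ} {F : (Fin m → ℝ) → ℝ}
    (hF : IsMinOfForms g F univ) : ConcaveOn ℝ univ F := by
  refine ⟨convex_univ, fun x _ y _ a b ha hb hab => ?_⟩
  obtain ⟨i, hi⟩ := (hF (a • x + b • y) (mem_univ _)).2
  rw [hi, affEval_combo _ _ _ hab]
  exact add_le_add (mul_le_mul_of_nonneg_left ((hF x (mem_univ _)).1 i) ha)
    (mul_le_mul_of_nonneg_left ((hF y (mem_univ _)).1 i) hb)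

/-- On a cell of the arrangement of the differences `g i - g j`, a form that is minimal at an
interior point in the sense of `exists_subset_arrCell_arrPos` remains minimal throughout. -/
theorem IsMinOfForms.isPiecewiseZAffine [Finite ι] {g : ι → (Fin m → ℤ) × ℝ}
    {F : (Fin m → ℝ) → ℝ} (hF : IsMinOfForms g F univ) : IsPiecewiseZAffine F := by
  have hneg := affEval_formDiff_swap (fun _ : Unit => g)
  refine ⟨_, (isRationalPolyhedralComplex_arrCells hneg).1, sUnion_arrCells hneg, ?_⟩
  rintro _ ⟨P, hP, rfl⟩
  rcases (arrCell (formDiff fun _ : Unit => g) P).eq_empty_or_nonempty with he | hne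
  · rw [he]
    exact ⟨_, isZAffineFunction_affEval (0, 0), eqOn_empty _ _⟩
  obtain ⟨x, hx, hsub⟩ := exists_subset_arrCell_arrPos hneg hP (convex_arrCell _ P) hne subset_rfl
  obtain ⟨hle, j, hj⟩ := hF x (mem_univ _)
  refine ⟨_, isZAffineFunction_affEval (g j), fun y hy => ?_⟩
  obtain ⟨hley, i, hi⟩ := hF y (mem_univ _)
  refine le_antisymm (hley j) ?_
  have h1 : ((), i, j) ∈ arrPos (formDiff fun _ : Unit => g) x :=
    mem_arrPos_formDiff.2 (hj ▸ hle i)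
  have h2 := hsub hy _ h1
  simp only [formDiff, affEval_sub] at h2
  linarith

end Min

/-! ### Unimodular matrices and unimodular maps -/

/-- Expressing the unit vectors through the rows gives an integral left inverse `B` of `A`. It
forces full rank, and it splits `A`: from `c y = A x` follows `y = A (B y)`. -/
theorem isUnimodularMatrix_of_span {k n : ℕ} (A : Matrix (Fin k) (Fin n) ℤ)
    (hA : Submodule.span ℤ (range A) = ⊤) : IsUnimodularMatrix A := by
  have h1 : ∀ i, ∃ c : Fin k → ℤ, ∑ j, c j • A j = Pi.single i 1 := fun i =>
    (Submodule.mem_span_range_iff_exists_fun ℤ).1 (hA ▸ Submodule.mem_top)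
  choose B hB using h1
  have hBA : Matrix.of B * A = 1 := by
    ext i l
    have := congrFun (hB i) l
    simp only [Finset.sum_apply, Pi.smul_apply, smul_eq_mul] at this
    rw [Matrix.mul_apply]
    simp only [Matrix.of_apply, this, Matrix.one_apply, Pi.single_apply, eq_comm]
  refine ⟨le_antisymm ?_ ?_, ⟨fun c hc => ?_⟩⟩
  · simpa using A.rank_le_width
  · have := Matrix.rank_mul_le_right (Matrix.of B) A
    rw [hBA, Matrix.rank_one] at this
    simpa using this
  · have hc0 : c ≠ 0 := hc.ne_zero
    refine isSMulRegular_iff_right_eq_zero_of_smul.2 fun y => ?_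
    obtain ⟨y, rfl⟩ := Submodule.Quotient.mk_surjective _ y
    intro hy
    rw [← Submodule.Quotient.mk_smul, Submodule.Quotient.mk_eq_zero] at hy
    rw [Submodule.Quotient.mk_eq_zero]
    obtain ⟨x, hx⟩ := hy
    refine ⟨(Matrix.of B).mulVec y, ?_⟩
    have h2 : c • A.mulVec ((Matrix.of B).mulVec y) = c • y := by
      rw [← Matrix.mulVec_smul, ← Matrix.mulVec_smul, ← hx, Matrix.mulVecLin_apply,
        Matrix.mulVec_mulVec _ (Matrix.of B), hBA, Matrix.one_mulVec]
    exact smul_right_injective _ hc0 h2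

/-- One arrangement, of the differences within every family `G s`, orders the forms of all the
minima at once. Minimizing forms chosen at one suitable point of a cell stay minimizing on the part
of the cell in `U`, so the spanning condition at that point settles the whole piece. -/
theorem isUnimodularOn_of_isMinOfForms {n k : ℕ} {ι : Type*} [Finite ι]
    {G : Fin (k + 1) → ι → (Fin n → ℤ) × ℝ} {F : Fin (k + 1) → (Fin n → ℝ) → ℝ}
    {U : Set (Fin n → ℝ)} (hU : IsOpen U) (hconv : Convex ℝ U) (hne : U.Nonempty)
    (hF : ∀ s, IsMinOfForms (G s) (F s) U)
    (hspan : ∀ x ∈ U, ∃ j : Fin (k + 1) → ι, (∀ s, F s x = affEval (G s (j s)) x) ∧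
      Submodule.span ℤ (range fun s : Fin k => (G s.succ (j s.succ)).1 - (G 0 (j 0)).1) = ⊤) :
    IsUnimodularOn (fun x (s : Fin k) => F s.succ x - F 0 x) U := by
  have hneg := affEval_formDiff_swap G
  refine ⟨_, isRationalPolyhedralComplex_arrCells hneg, ⟨U, hU, ?_⟩, ?_⟩
  · rw [sUnion_arrCells hneg, inter_univ]
  rintro _ ⟨P, hP, rfl⟩
  have key : ∀ j : Fin (k + 1) → ι,
      Submodule.span ℤ (range fun s : Fin k => (G s.succ (j s.succ)).1 - (G 0 (j 0)).1) = ⊤ →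
      IsUnimodularZAffine fun x (s : Fin k) =>
        affEval (G s.succ (j s.succ)) x - affEval (G 0 (j 0)) x := by
    intro j hj
    refine ⟨fun s => (G s.succ (j s.succ)).1 - (G 0 (j 0)).1,
      fun s => (G s.succ (j s.succ)).2 - (G 0 (j 0)).2, isUnimodularMatrix_of_span _ hj, ?_⟩
    intro x
    ext s
    exact (affEval_sub _ _ _).symm
  rcases (arrCell (formDiff G) P ∩ U).eq_empty_or_nonempty with he | hne'
  -- A cell that misses `U` still has to be given some unimodular map; any point of `U` provides
  -- one.
  · obtain ⟨x, hx⟩ := hne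
    obtain ⟨j, -, hj⟩ := hspan x hx
    rw [he]
    exact ⟨_, key j hj, eqOn_empty _ _⟩
  obtain ⟨x, ⟨hxP, hxU⟩, hsub⟩ := exists_subset_arrCell_arrPos hneg hP
    ((convex_arrCell _ P).inter hconv) hne' inter_subset_left
  obtain ⟨j, hj, hjs⟩ := hspan x hxU
  refine ⟨_, key j hjs, fun y hy => ?_⟩
  have hFy : ∀ s, F s y = affEval (G s (j s)) y := by
    intro s
    obtain ⟨hle, i, hi⟩ := hF s y hy.2
    refine le_antisymm (hle _) ?_
    have h1 : (s, i, j s) ∈ arrPos (formDiff G) x :=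
      mem_arrPos_formDiff.2 (hj s ▸ (hF s x hxU).1 i)
    have h2 := hsub hy _ h1
    simp only [formDiff, affEval_sub] at h2
    linarith
  ext s
  exact congrArg₂ _ (hFy _) (hFy _)

/-! ### Minima of a positive definite form over the cosets of a lattice -/

section LatticeMin

variable {V : Type u} [NormedAddCommGroup V] [NormedSpace ℝ V]

/-- The quadratic form `x ↦ Q(x, x) / 2`. -/
noncomputable def halfQuad (Q : V →ₗ[ℝ] V →ₗ[ℝ] ℝ) (x : V) : ℝ := Q x x / 2

variable {Q : V →ₗ[ℝ] V →ₗ[ℝ] ℝ}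

theorem halfQuad_add (hs : ∀ x y, Q x y = Q y x) (x y : V) :
    halfQuad Q (x + y) = halfQuad Q x + Q x y + halfQuad Q y := by
  simp only [halfQuad, map_add, LinearMap.add_apply, hs y x]
  ring

theorem halfQuad_smul (c : ℝ) (x : V) : halfQuad Q (c • x) = c ^ 2 * halfQuad Q x := by
  simp only [halfQuad, map_smul, LinearMap.smul_apply, smul_eq_mul]
  ring

theorem halfQuad_neg (x : V) : halfQuad Q (-x) = halfQuad Q x := by
  simp [halfQuad]

theorem halfQuad_pos (hp : ∀ x, x ≠ 0 → 0 < Q x x) {x : V} (hx : x ≠ 0) : 0 < halfQuad Q x :=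
  half_pos (hp x hx)

theorem halfQuad_nonneg (hp : ∀ x, x ≠ 0 → 0 < Q x x) (x : V) : 0 ≤ halfQuad Q x := by
  rcases eq_or_ne x 0 with rfl | hx
  · simp [halfQuad]
  · exact (halfQuad_pos hp hx).le

/-- The minimum of the form on the coset `t + Λ`. -/
noncomputable def latMin (Q : V →ₗ[ℝ] V →ₗ[ℝ] ℝ) (Λ : Submodule ℤ V) (t : V) : ℝ :=
  ⨅ u : Λ, halfQuad Q (t + u)

theorem latMin_eq (Λ : Submodule ℤ V) (hp : ∀ x, x ≠ 0 → 0 < Q x x) {t : V} {u : Λ}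
    (hu : ∀ u' : Λ, halfQuad Q (t + u) ≤ halfQuad Q (t + u')) :
    latMin Q Λ t = halfQuad Q (t + u) :=
  le_antisymm (ciInf_le ⟨0, by rintro _ ⟨u, rfl⟩; exact halfQuad_nonneg hp _⟩ u) (le_ciInf hu)

theorem latMin_le (Λ : Submodule ℤ V) (hp : ∀ x, x ≠ 0 → 0 < Q x x) (t : V) (u : Λ) :
    latMin Q Λ t ≤ halfQuad Q (t + u) :=
  ciInf_le ⟨0, by rintro _ ⟨u, rfl⟩; exact halfQuad_nonneg hp _⟩ u

theorem latMin_add (Λ : Submodule ℤ V) (t : V) (v : Λ) : latMin Q Λ (t + v) = latMin Q Λ t := by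
  refine (Equiv.addLeft v).iInf_congr fun u => ?_
  simp [add_assoc]

variable [FiniteDimensional ℝ V]

theorem continuous_halfQuad : Continuous (halfQuad Q) := by
  have h : Continuous ((LinearMap.toContinuousLinearMap : (V →ₗ[ℝ] ℝ) ≃ₗ[ℝ] (V →L[ℝ] ℝ)).toLinearMap
      ∘ₗ Q) := LinearMap.continuous_of_finiteDimensional _
  exact (h.clm_apply continuous_id).div_const 2

theorem exists_norm_sq_le_halfQuad (hp : ∀ x, x ≠ 0 → 0 < Q x x) :
    ∃ c > 0, ∀ x, c * ‖x‖ ^ 2 ≤ halfQuad Q x := by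
  rcases (Metric.sphere (0 : V) 1).eq_empty_or_nonempty with he | hne
  · refine ⟨1, one_pos, fun x => ?_⟩
    rcases eq_or_ne x 0 with rfl | hx
    · simp [halfQuad]
    · have : ‖x‖⁻¹ • x ∈ Metric.sphere (0 : V) 1 := by
        simp [norm_smul, inv_mul_cancel₀ (norm_ne_zero_iff.2 hx)]
      rw [he] at this
      exact absurd this (notMem_empty _)
  · obtain ⟨x₀, hx₀, hmin⟩ := (isCompact_sphere (0 : V) 1).exists_isMinOn hne
      (continuous_halfQuad (Q := Q)).continuousOn
    have hx₀0 : x₀ ≠ 0 := by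
      rintro rfl
      simp at hx₀
    refine ⟨_, halfQuad_pos hp hx₀0, fun x => ?_⟩
    rcases eq_or_ne x 0 with rfl | hx
    · simp [halfQuad]
    · have h1 : ‖x‖⁻¹ • x ∈ Metric.sphere (0 : V) 1 := by
        simp [norm_smul, inv_mul_cancel₀ (norm_ne_zero_iff.2 hx)]
      have h2 : halfQuad Q x₀ ≤ halfQuad Q (‖x‖⁻¹ • x) := hmin h1
      rw [halfQuad_smul] at h2
      have h3 : 0 < ‖x‖ := norm_pos_iff.2 hx
      calc _ ≤ _ := mul_le_mul_of_nonneg_right h2 (sq_nonneg _)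
        _ = halfQuad Q x := by field_simp

variable (Λ : Submodule ℤ V) [DiscreteTopology Λ]

theorem finite_lattice_norm_le (R : ℝ) : {u : Λ | ‖(u : V)‖ ≤ R}.Finite := by
  have hcl : IsClosed (Λ : Set V) :=
    @AddSubgroup.isClosed_of_discrete _ _ _ _ _ Λ.toAddSubgroup ‹_›
  have h := Metric.finite_isBounded_inter_isClosed (K := Metric.closedBall (0 : V) R)
    (s := (Λ : Set V)) DiscreteTopology.isDiscrete Metric.isBounded_closedBall hcl
  refine (h.preimage (f := fun u : Λ => (u : V)) Subtype.val_injective.injOn).subset ?_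
  intro u hu
  exact ⟨by simpa using hu, u.2⟩

/-- For `t` in a bounded set, the minimum of `q (t + u)` over the lattice is attained only on a
finite set. -/
theorem exists_finset_halfQuad_lt (hp : ∀ x, x ≠ 0 → 0 < Q x x) (R : ℝ) :
    ∃ T : Finset Λ, 0 ∈ T ∧ ∀ t : V, ‖t‖ ≤ R → ∀ u : Λ, u ∉ T →
      halfQuad Q t < halfQuad Q (t + u) := by
  classical
  obtain ⟨c, hc, hcq⟩ := exists_norm_sq_le_halfQuad hp
  obtain ⟨B, hB⟩ := ((isCompact_closedBall (0 : V) R).image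
    (continuous_halfQuad (Q := Q))).bddAbove
  -- Beyond this radius `‖t + u‖ > B / c + 1 ≥ 1`, whence `c ‖t + u‖² > B ≥ q(t)`. The vector `0` is
  -- adjoined so that a minimum over the finite set can be compared with `q(t)`.
  refine ⟨insert 0 (finite_lattice_norm_le Λ (R + (B / c + 1))).toFinset,
    Finset.mem_insert_self _ _, fun t ht u hu => ?_⟩
  have htB : halfQuad Q t ≤ B := hB ⟨t, by simpa using ht, rfl⟩
  have hB0 : 0 ≤ B := (halfQuad_nonneg hp t).trans htB
  have hu' : R + (B / c + 1) < ‖(u : V)‖ := by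
    by_contra hcon
    exact hu (Finset.mem_insert_of_mem (by simpa using hcon))
  have h1 : ‖(u : V)‖ ≤ ‖t + u‖ + ‖t‖ := by
    have := norm_sub_le (t + u : V) t
    rwa [add_sub_cancel_left] at this
  have h2 : B / c + 1 < ‖t + u‖ := by linarith
  have h3 : 0 ≤ B / c := by positivity
  have h4 : B / c < ‖t + u‖ ^ 2 := by nlinarith
  have h5 : B < c * ‖t + u‖ ^ 2 := by
    rw [div_lt_iff₀ hc] at h4
    linarith
  linarith [hcq (t + u)]

theorem exists_forall_halfQuad_le (hp : ∀ x, x ≠ 0 → 0 < Q x x) (t : V) :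
    ∃ u : Λ, ∀ u' : Λ, halfQuad Q (t + u) ≤ halfQuad Q (t + u') := by
  obtain ⟨T, h0, hT⟩ := exists_finset_halfQuad_lt Λ hp ‖t‖
  obtain ⟨u, -, hu⟩ := T.exists_min_image (fun u : Λ => halfQuad Q (t + u)) ⟨0, h0⟩
  refine ⟨u, fun u' => ?_⟩
  by_cases h : u' ∈ T
  · exact hu _ h
  · have h1 := hu 0 h0
    simp only [ZeroMemClass.coe_zero, add_zero] at h1
    exact h1.trans (hT t le_rfl u' h).le

theorem exists_latMin_eq (hp : ∀ x, x ≠ 0 → 0 < Q x x) (t : V) :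
    ∃ u : Λ, latMin Q Λ t = halfQuad Q (t + u) :=
  (exists_forall_halfQuad_le Λ hp t).imp fun _ hu => latMin_eq Λ hp hu

theorem latMin_nonneg (hp : ∀ x, x ≠ 0 → 0 < Q x x) (t : V) : 0 ≤ latMin Q Λ t := by
  obtain ⟨u, hu⟩ := exists_latMin_eq Λ hp t
  exact hu ▸ halfQuad_nonneg hp _

theorem latMin_zero (hp : ∀ x, x ≠ 0 → 0 < Q x x) : latMin Q Λ 0 = 0 := by
  refine le_antisymm ?_ (latMin_nonneg Λ hp 0)
  simpa [halfQuad] using latMin_le Λ hp 0 0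

theorem mem_of_latMin_eq_zero (hp : ∀ x, x ≠ 0 → 0 < Q x x) {t : V} (ht : latMin Q Λ t = 0) :
    t ∈ Λ := by
  obtain ⟨u, hu⟩ := exists_latMin_eq Λ hp t
  by_contra h
  have : t + u ≠ 0 := by
    intro h0
    rw [eq_neg_of_add_eq_zero_left h0] at h
    exact h (neg_mem u.2)
  linarith [halfQuad_pos hp this]

theorem exists_forall_exists_norm_add_le [IsZLattice ℝ Λ] :
    ∃ R, ∀ t : V, ∃ u : Λ, ‖t + u‖ ≤ R := by
  have : Module.Finite ℤ Λ := ZLattice.module_finite ℝ Λ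
  have : Module.Free ℤ Λ := ZLattice.module_free ℝ Λ
  set b := (Module.finBasis ℤ Λ).ofZLatticeBasis ℝ Λ
  have hspan : Submodule.span ℤ (range b) = Λ := Module.Basis.ofZLatticeBasis_span ℝ _ _
  refine ⟨∑ i, ‖b i‖, fun t => ?_⟩
  have h1 : ((ZSpan.floor b t : Submodule.span ℤ (range b)) : V) ∈ Λ :=
    hspan.le (Subtype.property _)
  refine ⟨-⟨_, h1⟩, ?_⟩
  have h3 := ZSpan.norm_fract_le b t
  rw [ZSpan.fract_apply] at h3
  simpa [← sub_eq_add_neg] using h3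

theorem latMin_bounded [IsZLattice ℝ Λ] (hp : ∀ x, x ≠ 0 → 0 < Q x x) :
    ∃ B, ∀ t, latMin Q Λ t ≤ B := by
  obtain ⟨R, hR⟩ := exists_forall_exists_norm_add_le Λ
  obtain ⟨B, hB⟩ := ((isCompact_closedBall (0 : V) R).image
    (continuous_halfQuad (Q := Q))).bddAbove
  refine ⟨B, fun t => ?_⟩
  obtain ⟨u, hu⟩ := hR t
  exact (latMin_le Λ hp t u).trans (hB ⟨_, by simpa using hu, rfl⟩)

/-! #### Separation of points -/

/-- This is the product `ϑ(x + a) ϑ(x + b) ϑ(x - a - b) ϑ(x)^e` in tropical form. The shifts add up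
to zero, so `3 + e` translates of `q` sum to `3 + e` copies of one translate `q(· + w)` plus a
constant, with `w ∈ (3 + e)⁻¹Λ`. Minimizers at `y` determine `w`, the hypothesis passes from `y + w`
to `y' + w`, and the same lattice vectors moved by a minimizer `v` for `y' + w` bound the minima at
`y'` from above. -/
theorem latMin_sum_le (hs : ∀ x y, Q x y = Q y x) (hp : ∀ x, x ≠ 0 → 0 < Q x x) (e : ℕ)
    {y y' : V} {c : ℝ}
    (H : ∀ w : V, ((3 + e : ℕ) : ℝ) • w ∈ Λ → latMin Q Λ (y + w) = latMin Q Λ (y' + w) + c)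
    (a b : V) :
    latMin Q Λ (y' + a) + latMin Q Λ (y' + b) + latMin Q Λ (y' + (-a - b)) + e * latMin Q Λ y' +
      (3 + e) * c ≤
    latMin Q Λ (y + a) + latMin Q Λ (y + b) + latMin Q Λ (y + (-a - b)) + e * latMin Q Λ y := by
  obtain ⟨u₁, h₁⟩ := exists_latMin_eq Λ hp (y + a)
  obtain ⟨u₂, h₂⟩ := exists_latMin_eq Λ hp (y + b)
  obtain ⟨u₃, h₃⟩ := exists_latMin_eq Λ hp (y + (-a - b))
  obtain ⟨u₀, h₀⟩ := exists_latMin_eq Λ hp y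
  have he : (0 : ℝ) < 3 + e := by positivity
  -- The mean of the `3 + e` minimizing lattice vectors, `u₀` counted `e` times.
  set w : V := ((3 : ℝ) + e)⁻¹ • ((u₁ : V) + u₂ + u₃ + (e : ℝ) • (u₀ : V)) with hw
  have hdw : ((3 : ℝ) + e) • w = (u₁ : V) + u₂ + u₃ + (e : ℝ) • (u₀ : V) := by
    rw [hw, smul_inv_smul₀ he.ne']
  have hwΛ : ((3 + e : ℕ) : ℝ) • w ∈ Λ := by
    push_cast
    rw [hdw]
    refine add_mem (add_mem (add_mem u₁.2 u₂.2) u₃.2) ?_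
    rw [Nat.cast_smul_eq_nsmul]
    exact nsmul_mem u₀.2 e
  obtain ⟨v, hv⟩ := exists_latMin_eq Λ hp (y' + w)
  -- Both sides have the same part quadratic and linear in `p`; the remaining constant does not
  -- depend on `p` and cancels between `p = y` and `p = y' + v`.
  have key : ∀ p : V, halfQuad Q (p + (a + u₁)) + halfQuad Q (p + (b + u₂)) +
      halfQuad Q (p + ((-a - b) + u₃)) + e * halfQuad Q (p + u₀) = (3 + e) * halfQuad Q (p + w) +
      (halfQuad Q (a + u₁) + halfQuad Q (b + u₂) + halfQuad Q ((-a - b) + u₃) +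
        e * halfQuad Q (u₀ : V) - (3 + e) * halfQuad Q w) := by
    intro p
    have h : ((3 : ℝ) + e) * Q p w = Q p (u₁ : V) + Q p u₂ + Q p u₃ + e * Q p u₀ := by
      rw [← smul_eq_mul, ← map_smul, hdw]
      simp only [map_add, map_smul, smul_eq_mul]
    simp only [halfQuad_add hs p]
    simp only [map_add, map_sub, map_neg]
    linear_combination -h
  have k1 := key y
  have k2 := key (y' + v)
  have k3 := H w hwΛ
  have k4 : latMin Q Λ (y + w) ≤ halfQuad Q (y + w) := by
    simpa using latMin_le Λ hp (y + w) 0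
  have l1 := latMin_le Λ hp (y' + a) (v + u₁)
  have l2 := latMin_le Λ hp (y' + b) (v + u₂)
  have l3 := latMin_le Λ hp (y' + (-a - b)) (v + u₃)
  have l0 := latMin_le Λ hp y' (v + u₀)
  rw [h₁, h₂, h₃, h₀]
  have r1 : ∀ p x : V, ∀ u v : Λ, p + x + ((v + u : Λ) : V) = p + v + (x + u) := fun p x u v => by
    push_cast
    abel
  have r2 : y' + ((v + u₀ : Λ) : V) = y' + v + u₀ := by push_cast; abel
  rw [r1] at l1 l2 l3
  rw [r2] at l0
  rw [add_assoc y' w, add_comm w, ← add_assoc] at hv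
  have k5 : ((3 : ℝ) + e) * halfQuad Q (y' + v + w) + (3 + e) * c ≤ (3 + e) * halfQuad Q (y + w) := by
    rw [← mul_add, ← hv]
    exact mul_le_mul_of_nonneg_left (k3 ▸ k4) he.le
  have l0' := mul_le_mul_of_nonneg_left l0 (Nat.cast_nonneg (α := ℝ) e)
  simp only [add_assoc y] at k1 ⊢
  linarith

/-- The functions `t ↦ min_{u ∈ Λ} q (t + w + u)`, with `w ∈ d⁻¹ Λ` and `d ≥ 3`, separate, up to a
common constant, the points of the torus. -/
theorem sub_mem_of_latMin_sub_eq [IsZLattice ℝ Λ] (hs : ∀ x y, Q x y = Q y x)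
    (hp : ∀ x, x ≠ 0 → 0 < Q x x) {d : ℕ} (hd : 3 ≤ d) {y y' : V} {c : ℝ}
    (H : ∀ w : V, (d : ℝ) • w ∈ Λ → latMin Q Λ (y + w) = latMin Q Λ (y' + w) + c) :
    y' - y ∈ Λ := by
  obtain ⟨e, rfl⟩ := Nat.exists_eq_add_of_le hd
  have H' : ∀ w : V, ((3 + e : ℕ) : ℝ) • w ∈ Λ →
      latMin Q Λ (y' + w) = latMin Q Λ (y + w) + -c := fun w hw => by
    rw [H w hw]
    ring
  have h0 : latMin Q Λ y = latMin Q Λ y' + c := by simpa using H 0 (by simp)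
  set h : V → ℝ := fun a => latMin Q Λ (y + a) - latMin Q Λ (y' + a) - c with hh
  -- The inequality and its counterpart with `y` and `y'` exchanged give equality.
  have hsum : ∀ a b, h a + h b + h (-a - b) = 0 := by
    intro a b
    have h1 := latMin_sum_le Λ hs hp e H a b
    have h2 := latMin_sum_le Λ hs hp e H' a b
    rw [h0] at h1 h2
    simp only [hh]
    apply le_antisymm <;> nlinarith
  have hz : h 0 = 0 := by simp [hh, h0]
  have hneg : ∀ a, h (-a) = -h a := fun a => by
    have := hsum a 0
    rw [hz, sub_zero] at this
    linarith
  have hadd : ∀ a b, h (a + b) = h a + h b := fun a b => by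
    have h1 := hsum a b
    rw [show -a - b = -(a + b) by abel, hneg] at h1
    linarith
  obtain ⟨B, hB⟩ := latMin_bounded Λ hp
  have hnsmul : ∀ (n : ℕ) a, h (n • a) = n * h a := fun n a => by
    induction n with
    | zero => simp [hz]
    | succ n ih =>
      rw [succ_nsmul, hadd, ih]
      push_cast
      ring
  -- An additive function bounded above cannot be positive anywhere, since its multiples would be
  -- unbounded; applied to `-a` as well, it is zero.
  have hle : ∀ a, h a ≤ 0 := by
    intro a
    by_contra hcon
    obtain ⟨n, hn⟩ := Archimedean.arch (B - c + 1) (not_le.1 hcon)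
    have h1 : h (n • a) ≤ B - c := by
      have := hB (y + n • a)
      have := latMin_nonneg Λ hp (y' + n • a)
      simp only [hh]
      linarith
    rw [hnsmul] at h1
    rw [nsmul_eq_mul] at hn
    linarith
  have hzero : ∀ a, h a = 0 := fun a =>
    le_antisymm (hle a) (by have := hle (-a); rw [hneg] at this; linarith)
  -- These two translations make one of the minima vanish: `c = -latMin Q Λ (y' - y)` and `c =
  -- latMin Q Λ (y - y')`. Both minima being nonnegative, they are zero.
  have e1 := hzero (-y)
  have e2 := hzero (-y')
  simp only [hh, add_neg_cancel, latMin_zero Λ hp, ← sub_eq_add_neg] at e1 e2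
  have n1 := latMin_nonneg Λ hp (y' - y)
  have n2 := latMin_nonneg Λ hp (y - y')
  exact mem_of_latMin_eq_zero Λ hp (by linarith)

end LatticeMin

/-! ### The minimizers in the cosets of a lattice generate -/

section Generate

variable {V : Type u} [NormedAddCommGroup V] [NormedSpace ℝ V]
  {Q : V →ₗ[ℝ] V →ₗ[ℝ] ℝ}

theorem halfQuad_le_add_iff (hs : ∀ x y, Q x y = Q y x) (t u : V) :
    halfQuad Q t ≤ halfQuad Q (t + u) ↔ 0 ≤ Q t u + halfQuad Q u := by
  rw [halfQuad_add hs]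
  constructor <;> intro h <;> linarith

/-- Along `a - b` the difference `q(z + a) - q(z + b)` has slope `Q(a - b, a - b) > 0`, so an
arbitrarily small step breaks a tie. -/
theorem dense_halfQuad_add_ne (hs : ∀ x y, Q x y = Q y x) (hp : ∀ x, x ≠ 0 → 0 < Q x x) {a b : V}
    (hab : a ≠ b) : Dense {z : V | halfQuad Q (z + a) ≠ halfQuad Q (z + b)} := by
  intro z
  by_cases hz : halfQuad Q (z + a) = halfQuad Q (z + b)
  swap
  · exact subset_closure hz
  have hlim : Tendsto (fun t : ℝ => z + t • (a - b)) (𝓝[>] 0) (𝓝 z) := by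
    have : ContinuousAt (fun t : ℝ => z + t • (a - b)) 0 := by fun_prop
    have h2 := this.tendsto
    rw [zero_smul, add_zero] at h2
    exact h2.mono_left nhdsWithin_le_nhds
  refine mem_closure_of_tendsto hlim ?_
  filter_upwards [self_mem_nhdsWithin] with t ht
  have ht : 0 < t := ht
  have h1 := mul_pos ht (hp _ (sub_ne_zero.2 hab))
  intro hcon
  simp only [halfQuad_add hs, map_add, LinearMap.add_apply, map_smul, LinearMap.smul_apply,
    smul_eq_mul] at hz hcon
  rw [map_sub] at h1
  linarith

variable [FiniteDimensional ℝ V] (Λ : Submodule ℤ V) [DiscreteTopology Λ]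

/-- The lattice is generated by the vectors that are shortest in their class modulo `2Λ`. -/
theorem mem_of_minimal_mod_two_mem (hs : ∀ x y, Q x y = Q y x) (hp : ∀ x, x ≠ 0 → 0 < Q x x)
    (G : AddSubgroup V)
    (hG : ∀ v : Λ, (∀ u : Λ, halfQuad Q v ≤ halfQuad Q (v + (u + u))) → (v : V) ∈ G) (v : Λ) :
    (v : V) ∈ G := by
  by_contra hv
  obtain ⟨c, hc, hcq⟩ := exists_norm_sq_le_halfQuad hp
  have hfin : {u : Λ | halfQuad Q u ≤ halfQuad Q v}.Finite := by
    refine (finite_lattice_norm_le Λ (halfQuad Q v / c + 1)).subset fun u hu => ?_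
    have h1 : c * ‖(u : V)‖ ^ 2 ≤ halfQuad Q v := (hcq u).trans hu
    have h2 : ‖(u : V)‖ ^ 2 ≤ halfQuad Q v / c := by
      rw [le_div_iff₀ hc]
      linarith
    have : ‖(u : V)‖ ≤ halfQuad Q v / c + 1 := by nlinarith [sq_nonneg (‖(u : V)‖ - 1)]
    exact this
  -- A shortest lattice vector outside `G`; it will turn out to be shortest modulo `2Λ`.
  obtain ⟨v₀, ⟨hv₀, hv₀G⟩, hmin⟩ := exists_min_image
    {u : Λ | halfQuad Q u ≤ halfQuad Q v ∧ (u : V) ∉ G} (fun u : Λ => halfQuad Q (u : V))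
    (hfin.subset fun u hu => hu.1) ⟨v, le_rfl, hv⟩
  have hsmall : ∀ u : Λ, halfQuad Q u < halfQuad Q v₀ → (u : V) ∈ G := by
    intro u hu
    by_contra hcon
    exact absurd (hmin u ⟨hu.le.trans hv₀, hcon⟩) (not_le.2 hu)
  refine hv₀G (hG v₀ fun u => ?_)
  by_contra hlt
  rw [not_le] at hlt
  -- By the parallelogram law, if `v₀ + 2u` were shorter than `v₀`, then `u` and `v₀ + u` would both
  -- be shorter than `v₀`, hence in `G`, and so would be their difference `v₀`.
  have hpar : halfQuad Q (v₀ : V) + halfQuad Q (v₀ + (u + u) : V) =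
      2 * halfQuad Q (v₀ + u : V) + 2 * halfQuad Q (u : V) := by
    simp only [halfQuad_add hs, map_add]
    simp only [halfQuad]
    ring
  have h1 := halfQuad_nonneg hp (u : V)
  have h2 := halfQuad_nonneg hp (v₀ + u : V)
  have h3 : (u : V) ∈ G := hsmall u (by linarith)
  have h4 : ((v₀ + u : Λ) : V) ∈ G := hsmall _ (by push_cast; linarith)
  apply hv₀G
  have := sub_mem h4 h3
  simpa using this

/-- Let `C` be the Voronoi cell of the origin, the set of `t` with `q(t) ≤ q(t + u)` for all `u ∈
Λ`. By uniqueness, every `s ∈ d⁻¹Λ` with `z + s ∈ C` is one of the `g r`. For `v` shortest modulo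
`2Λ` both `v / 2` and `-v / 2` lie in `C`; with `y ∈ C`, convexity puts the two points `d⁻¹ (± v /
2) + d⁻¹ (d - 1) y` in `C`. They differ by `v / d`, and `y` can be chosen so that both lie in `z +
d⁻¹Λ`. Hence `v / d` is a difference of two of the `g r`. -/
theorem mem_of_unique_minimizers (hs : ∀ x y, Q x y = Q y x) (hp : ∀ x, x ≠ 0 → 0 < Q x x)
    {d : ℕ} (hd : 2 ≤ d) {κ : Type*} {w g : κ → V} {z : V}
    (hw : ∀ v : Λ, ∃ r, (d : ℝ)⁻¹ • (v : V) - w r ∈ Λ) (hgw : ∀ r, g r - w r ∈ Λ)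
    (huniq : ∀ r, ∀ u : Λ, halfQuad Q (z + g r + u) ≤ halfQuad Q (z + g r) → u = 0)
    (G : AddSubgroup V) (hG : ∀ r r', g r - g r' ∈ G) (r : κ) : w r ∈ G := by
  have hd0 : (0 : ℝ) < d := by positivity
  have hd1 : (0 : ℝ) < d - 1 := by
    have : (2 : ℝ) ≤ d := by exact_mod_cast hd
    linarith
  have hsite : ∀ v : Λ, (∀ u : Λ, halfQuad Q (z + (d : ℝ)⁻¹ • (v : V)) ≤
      halfQuad Q (z + (d : ℝ)⁻¹ • (v : V) + u)) → ∃ r, (d : ℝ)⁻¹ • (v : V) = g r := by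
    intro v hv
    obtain ⟨r, hr⟩ := hw v
    refine ⟨r, ?_⟩
    have h1 : (d : ℝ)⁻¹ • (v : V) - g r ∈ Λ := by
      have := sub_mem hr (hgw r)
      simpa using this
    have h2 := huniq r ⟨_, h1⟩ (by
      have := hv (-⟨_, h1⟩)
      simpa [add_assoc] using this)
    exact sub_eq_zero.1 (congrArg Subtype.val h2)
  have hdiv : ∀ v : Λ, (d : ℝ)⁻¹ • (v : V) ∈ G := by
    have := mem_of_minimal_mod_two_mem Λ hs hp
      (G.comap (DistribSMul.toAddMonoidHom V (d : ℝ)⁻¹)) ?_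
    · exact this
    intro v hv
    -- Solving `z + d⁻¹ (d - 1) u = d⁻¹ (v / 2) + d⁻¹ (d - 1) y` for `y` gives this vector plus `u`.
    -- The lattice vector `u` is free and is chosen to bring `y` into the Voronoi cell.
    obtain ⟨u, hu⟩ := exists_forall_halfQuad_le Λ hp
      (((d : ℝ) / (d - 1)) • (z - (2 * d : ℝ)⁻¹ • (v : V)))
    have hu' : ∀ u' : Λ, 0 ≤
        Q (((d : ℝ) / (d - 1)) • (z - (2 * d : ℝ)⁻¹ • (v : V)) + u) u' + halfQuad Q (u' : V) := by
      intro u'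
      rw [← halfQuad_le_add_iff hs, add_assoc]
      exact hu (u + u')
    -- The condition `q(v) ≤ q(v + 2u')`, divided by 4, says that `v / 2` lies in the Voronoi cell.
    have hv' : ∀ u' : Λ, 0 ≤ Q ((2 : ℝ)⁻¹ • (v : V)) u' + halfQuad Q (u' : V) := by
      intro u'
      have := (halfQuad_le_add_iff hs _ _).1 (hv u')
      have h2 : halfQuad Q (u' + u' : V) = 4 * halfQuad Q (u' : V) := by
        rw [← two_smul ℝ, halfQuad_smul]
        norm_num
      rw [h2, map_add] at this
      rw [map_smul, LinearMap.smul_apply, smul_eq_mul]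
      linarith
    have hv'' : ∀ u' : Λ, 0 ≤ -Q ((2 : ℝ)⁻¹ • (v : V)) u' + halfQuad Q (u' : V) := by
      intro u'
      have := hv' (-u')
      simpa [halfQuad_neg] using this
    have e1 : z + (d : ℝ)⁻¹ • ((((d - 1 : ℤ) • u) : Λ) : V) =
        (d : ℝ)⁻¹ • ((2 : ℝ)⁻¹ • (v : V)) +
          ((d - 1) / d : ℝ) • (((d : ℝ) / (d - 1)) • (z - (2 * d : ℝ)⁻¹ • (v : V)) + (u : V)) := by
      rw [Submodule.coe_smul, ← Int.cast_smul_eq_zsmul ℝ]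
      push_cast
      rw [smul_add, smul_smul ((d - 1) / d : ℝ), show ((d - 1) / d : ℝ) * (d / (d - 1)) = 1 by
        field_simp, one_smul, smul_smul, smul_smul, mul_inv, mul_comm (2 : ℝ)⁻¹, div_eq_inv_mul]
      abel
    have e2 : z + (d : ℝ)⁻¹ • ((((d - 1 : ℤ) • u - v) : Λ) : V) =
        -(d : ℝ)⁻¹ • ((2 : ℝ)⁻¹ • (v : V)) +
          ((d - 1) / d : ℝ) • (((d : ℝ) / (d - 1)) • (z - (2 * d : ℝ)⁻¹ • (v : V)) + (u : V)) := by
      have e3 : (d : ℝ)⁻¹ • (v : V) = (d : ℝ)⁻¹ • ((2 : ℝ)⁻¹ • (v : V)) +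
          (d : ℝ)⁻¹ • ((2 : ℝ)⁻¹ • (v : V)) := by
        rw [← smul_add, ← add_smul]
        norm_num
      rw [AddSubgroupClass.coe_sub, smul_sub, ← add_sub_assoc, e1, e3, neg_smul]
      abel
    have hcoef : 0 < ((d : ℝ) - 1) / d := by positivity
    have hcsum : (d : ℝ)⁻¹ + (d - 1) / d = 1 := by
      field_simp
      ring
    have hdinv : 0 < (d : ℝ)⁻¹ := by positivity
    -- The inequalities `0 ≤ Q(t, u') + q(u')` defining the cell are affine in `t`, so they pass to
    -- convex combinations.
    obtain ⟨r₁, h₁⟩ := hsite ((d - 1 : ℤ) • u) fun u' => by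
      rw [halfQuad_le_add_iff hs, e1]
      have a1 := mul_nonneg hdinv.le (hv' u')
      have a2 := mul_nonneg hcoef.le (hu' u')
      rw [map_add, map_smul, map_smul _ ((d - 1) / d : ℝ)]
      simp only [LinearMap.add_apply, LinearMap.smul_apply, smul_eq_mul] at a1 a2 ⊢
      linear_combination a1 + a2 + (halfQuad Q (u' : V)) * hcsum
    obtain ⟨r₂, h₂⟩ := hsite ((d - 1 : ℤ) • u - v) fun u' => by
      rw [halfQuad_le_add_iff hs, e2]
      have a1 := mul_nonneg hdinv.le (hv'' u')
      have a2 := mul_nonneg hcoef.le (hu' u')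
      rw [map_add, map_smul, map_smul _ ((d - 1) / d : ℝ)]
      simp only [LinearMap.add_apply, LinearMap.smul_apply, smul_eq_mul] at a1 a2 ⊢
      linear_combination a1 + a2 + (halfQuad Q (u' : V)) * hcsum
    have := hG r₁ r₂
    rw [← h₁, ← h₂, ← smul_sub] at this
    simpa using this
  have hΛ : ∀ v ∈ Λ, v ∈ G := by
    intro v hv
    have := hdiv ((d : ℤ) • ⟨v, hv⟩)
    rw [Submodule.coe_smul, ← Int.cast_smul_eq_zsmul ℝ, Int.cast_natCast,
      inv_smul_smul₀ hd0.ne'] at this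
    exact this
  -- The class of `0` is represented by some `w r₀ ∈ Λ`; every other `w r` differs from it by a
  -- difference of the `g r`, up to `Λ ⊆ G`.
  obtain ⟨r₀, h₀⟩ := hw 0
  have h₀' : w r₀ ∈ G := by
    have := hΛ _ h₀
    simpa using this
  have h1 : w r - w r₀ = (g r - g r₀) - ((g r - w r) - (g r₀ - w r₀)) := by abel
  have h2 : w r - w r₀ ∈ G := by
    rw [h1]
    exact sub_mem (hG _ _) (sub_mem (hΛ _ (hgw r)) (hΛ _ (hgw r₀)))
  simpa using add_mem h2 h₀'

/-- In each of finitely many cosets one can choose a vector `g r` that minimizes `q (x + ·)` in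
such a way that the differences of the `g r` generate a group that contains all cosets. -/
theorem exists_minimizers_generate [IsZLattice ℝ Λ] (hs : ∀ x y, Q x y = Q y x)
    (hp : ∀ x, x ≠ 0 → 0 < Q x x) {d : ℕ} (hd : 2 ≤ d) {κ : Type*} [Finite κ] {w : κ → V}
    (hw : ∀ v : Λ, ∃ r, (d : ℝ)⁻¹ • (v : V) - w r ∈ Λ) (x : V) :
    ∃ u : κ → Λ, (∀ r, ∀ u' : Λ, halfQuad Q (x + w r + u r) ≤ halfQuad Q (x + w r + u')) ∧
      ∀ G : AddSubgroup V, (∀ r r', (w r + u r) - (w r' + u r') ∈ G) → ∀ r, w r ∈ G := by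
  choose T hT0 hT using fun r => exists_finset_halfQuad_lt Λ hp (‖x + w r‖ + 1)
  have hcont : ∀ a : V, Continuous fun z : V => halfQuad Q (z + a) := fun a =>
    continuous_halfQuad.comp (by fun_prop)
  -- A vector that fails to minimize at `x` fails by a strict inequality, which persists nearby. As
  -- `T r` is finite, minimizers at a nearby `z` also minimize at `x`.
  have hev : ∀ᶠ z in 𝓝 x, ∀ r, ∀ u ∈ T r,
      (∀ u' : Λ, halfQuad Q (z + w r + u) ≤ halfQuad Q (z + w r + u')) →
      ∀ u' : Λ, halfQuad Q (x + w r + u) ≤ halfQuad Q (x + w r + u') := by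
    refine eventually_all.2 fun r => (T r).eventually_all.2 fun u _ => ?_
    by_cases h : ∀ u' : Λ, halfQuad Q (x + w r + u) ≤ halfQuad Q (x + w r + u')
    · exact Eventually.of_forall fun _ _ => h
    · push Not at h
      obtain ⟨u', hu'⟩ := h
      simp only [add_assoc] at hu' ⊢
      filter_upwards [((hcont _).tendsto x).eventually_lt ((hcont _).tendsto x) hu'] with z hz hz'
      exact absurd (hz' u') (not_le.2 hz)
  have hev2 : ∀ᶠ z in 𝓝 x, ∀ r, ‖z + w r‖ ≤ ‖x + w r‖ + 1 := by
    refine eventually_all.2 fun r => ?_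
    have : Continuous fun z : V => ‖z + w r‖ := by fun_prop
    exact (this.tendsto x).eventually (ge_mem_nhds (by linarith))
  have : Countable κ := Finite.to_countable
  -- Baire's theorem, for the countably many pairs of vectors in a common coset: at a generic `z` no
  -- two of them tie.
  have hdense : Dense (⋂ i : {i : κ × Λ × Λ // i.2.1 ≠ i.2.2},
      {z : V | halfQuad Q (z + (w i.1.1 + i.1.2.1)) ≠ halfQuad Q (z + (w i.1.1 + i.1.2.2))}) := by
    refine dense_iInter_of_isOpen (fun i => ?_) fun i => dense_halfQuad_add_ne hs hp ?_
    · exact isOpen_ne_fun (hcont _) (hcont _)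
    · exact fun h => i.2 (Subtype.ext (add_left_cancel h))
  obtain ⟨z, hzgen, hz1, hz2⟩ := hdense.inter_nhds_nonempty (hev.and hev2)
  choose u hu using fun r => exists_forall_halfQuad_le Λ hp (z + w r)
  have huT : ∀ r, u r ∈ T r := by
    intro r
    by_contra hcon
    have h1 := hT r _ (hz2 r) _ hcon
    have h2 := hu r 0
    simp only [ZeroMemClass.coe_zero, add_zero] at h2
    linarith
  refine ⟨u, fun r => hz1 r _ (huT r) (hu r), fun G hG r => ?_⟩
  refine mem_of_unique_minimizers Λ hs hp hd hw (g := fun r => w r + u r) (z := z)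
    (fun r => by simp) (fun r u' hu' => ?_) G hG r
  by_contra hne
  have h1 := mem_iInter.1 hzgen ⟨(r, u r + u', u r), by simpa using hne⟩
  refine h1 (le_antisymm ?_ ?_)
  · simpa [add_assoc] using hu'
  · have := hu r (u r + u')
    simpa [add_assoc] using this

end Generate

/-! ### Integral affine functions -/

theorem IsZAffineFunction.exists_affEval {m : ℕ} {f : (Fin m → ℝ) → ℝ} (hf : IsZAffineFunction f) :
    ∃ h : (Fin m → ℤ) × ℝ, ∀ x, f x = affEval h x := by
  obtain ⟨a, b, h⟩ := hf
  exact ⟨(a, b), h⟩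

theorem IsZAffineFunction.comp {m k : ℕ} {f : (Fin k → ℝ) → ℝ} {F : (Fin m → ℝ) → (Fin k → ℝ)}
    (hf : IsZAffineFunction f) (hF : IsZAffine F) : IsZAffineFunction fun x => f (F x) := by
  obtain ⟨a, b, hf⟩ := hf
  obtain ⟨A, c, hF⟩ := hF
  refine ⟨Matrix.vecMul a A, ∑ i, (a i : ℝ) * c i + b, fun x => ?_⟩
  have h1 : ∑ i, (a i : ℝ) * ((A.map (Int.cast : ℤ → ℝ)).mulVec x) i =
      ∑ i, ((Matrix.vecMul a A i : ℤ) : ℝ) * x i := by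
    simp only [Matrix.mulVec, Matrix.vecMul, dotProduct, Matrix.map_apply, Finset.mul_sum,
      Int.cast_sum, Int.cast_mul, Finset.sum_mul]
    rw [Finset.sum_comm]
    simp only [mul_assoc]
  change f (F x) = _
  rw [hf, hF, ← h1, ← add_assoc, ← Finset.sum_add_distrib]
  simp only [Pi.add_apply, mul_add]

theorem IsZAffineFunction.sub_nat_mul {m : ℕ} {f g : (Fin m → ℝ) → ℝ} (hf : IsZAffineFunction f)
    (hg : IsZAffineFunction g) (d : ℕ) : IsZAffineFunction fun x => f x - d * g x := by
  obtain ⟨a, b, hf⟩ := hf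
  obtain ⟨a', b', hg⟩ := hg
  refine ⟨fun i => a i - d * a' i, b - d * b', fun x => ?_⟩
  change f x - d * g x = _
  rw [hf, hg, mul_add, Finset.mul_sum]
  have : ∑ i, (((a i - d * a' i : ℤ)) : ℝ) * x i =
      ∑ i, (a i : ℝ) * x i - ∑ i, (d : ℝ) * ((a' i : ℝ) * x i) := by
    rw [← Finset.sum_sub_distrib]
    refine Finset.sum_congr rfl fun i _ => ?_
    push_cast
    ring
  rw [this]
  ring

theorem IsZAffine.continuous {m k : ℕ} {F : (Fin m → ℝ) → (Fin k → ℝ)} (hF : IsZAffine F) :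
    Continuous F := by
  obtain ⟨A, c, hF⟩ := hF
  rw [funext hF]
  exact (Continuous.matrix_mulVec continuous_const continuous_id).add continuous_const

theorem exists_isMinOfForms {m : ℕ} {ι : Type*} [Finite ι] [Nonempty ι]
    (g : ι → (Fin m → ℤ) × ℝ) : ∃ F, IsMinOfForms g F univ := by
  choose j hj using fun x => Finite.exists_min fun i => affEval (g i) x
  exact ⟨fun x => affEval (g (j x)) x, fun x _ => ⟨hj x, j x, rfl⟩⟩

/-- A function that agrees near every point of `U` with a minimum of finitely many integral affine
functions is locally concave and piecewise `ℤ`-affine. -/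
theorem isLocallyConcaveOn_and_isPiecewiseZAffineOn {m : ℕ} {φ : (Fin m → ℝ) → ℝ}
    {U : Set (Fin m → ℝ)}
    (h : ∀ p ∈ U, ∃ (S : Set ((Fin m → ℤ) × ℝ)) (F : (Fin m → ℝ) → ℝ), S.Finite ∧
      IsMinOfForms (fun g : S => g.1) F univ ∧ φ =ᶠ[𝓝[U] p] F) :
    IsLocallyConcaveOn φ U ∧ IsPiecewiseZAffineOn φ U := by
  refine ⟨fun p hp => ?_, fun p hp => ?_⟩
  · obtain ⟨S, F, -, hF, hφ⟩ := h p hp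
    obtain ⟨O, hO, hpO, hOs⟩ := mem_nhdsWithin.1 hφ
    exact ⟨O, hO, hpO, univ, F, subset_univ _, fun y hy => hOs hy, hF.concaveOn⟩
  · obtain ⟨S, F, hS, hF, hφ⟩ := h p hp
    have := hS.to_subtype
    exact ⟨F, hF.isPiecewiseZAffine, hφ⟩

theorem RationalPolyhedralChart.overlap_mem_nhdsWithin {X : Type*} [TopologicalSpace X]
    (c c' : RationalPolyhedralChart X) {y : Fin c.dim → ℝ} (hy : y ∈ c.equiv.target)
    (hy' : c.equiv.symm y ∈ c'.equiv.source) : c.overlap c' ∈ 𝓝[c.equiv.target] y := by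
  have h1 := (c.continuousOn_symm y hy).preimage_mem_nhdsWithin (c'.isOpen_source.mem_nhds hy')
  filter_upwards [h1, self_mem_nhdsWithin] with z hz hzt
  exact ⟨_, ⟨c.equiv.map_target hzt, hz⟩, c.equiv.right_inv hzt⟩

/-! ### Sections of the multiples of a positive line bundle -/

section Sections

theorem RealTorus.exists_mk_eq {V : Type u} [NormedAddCommGroup V]
    {N Λ : Submodule ℤ V} (x : RealTorus N Λ) : ∃ v : V, RealTorus.mk N Λ v = x :=
  QuotientAddGroup.mk_surjective x

variable {V : Type u} [NormedAddCommGroup V] [NormedSpace ℝ V]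

/-- `Λ` acts freely on `V`, so an orbit meets each fibre `{v} × 𝕋` at most once. This is what makes
an isomorphism determine well-defined heights over `V`. -/
theorem TropicalDescentDatum.toTotal_inj {N Λ : Submodule ℤ V} (D : TropicalDescentDatum N Λ)
    {v : V} {a b : Trop}
    (h : D.toTotal (v, a) = D.toTotal (v, b)) : a = b := by
  obtain ⟨u, hu⟩ := D.toTotal_eq.1 h
  have h1 : v = v + u := congrArg Prod.fst hu
  have h2 : u = 0 := Subtype.ext (by simpa using h1)
  rw [h2, D.act_zero] at hu
  exact (congrArg Prod.snd hu).symm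

variable [FiniteDimensional ℝ V]
  {N Λ : Submodule ℤ V} [DiscreteTopology N] [IsZLattice ℝ N] [DiscreteTopology Λ]

theorem isZAffineFunction_comp_latticeCoord (f : dualLattice N) (r : ℝ) :
    IsZAffineFunction fun y => f.1 ((latticeCoord N).symm y) + r := by
  simpa using isZAffineFunction_latticeCoord (-f) (-r)

/-- An isomorphism of `L` with `L(λ, γ)`, in the local trivializations of `L` and the global
trivialization of the pull-back of `L(λ, γ)` to `V`. -/
theorem exists_isomorphism_cocycle {L : TropicalLineBundle.{u, v} (RealTorus N Λ)}
    {D : TropicalDescentDatum N Λ} (hL : L.IsIsomorphic D.lineBundle) :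
    ∃ τ : L.atlas → V → ℝ,
      (∀ (p : L.atlas) (v : V) (u : Λ), RealTorus.mk N Λ v ∈ p.1.1.equiv.source →
        τ p (v + u) = τ p v - (D.lam u).1 v - D.gam u) ∧
      (∀ (p q : L.atlas) (v : V), RealTorus.mk N Λ v ∈ p.1.1.equiv.source ∩ q.1.1.equiv.source →
        τ p v = L.transitionFun p q (RealTorus.mk N Λ v) + τ q v) ∧
      ∀ (p : L.atlas) (W : TorusPatch N Λ), ∃ t : (Fin p.1.1.dim → ℝ) → ℝ,
        IsTropicalFunctionOn t (p.1.1.overlap (torusChart N Λ W)) ∧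
          ∀ v ∈ W.1, RealTorus.mk N Λ v ∈ p.1.1.equiv.source →
            τ p v = t (p.1.1.equiv (RealTorus.mk N Λ v)) := by
  obtain ⟨f, hf, ht⟩ := hL
  have hW : ∀ (p : L.atlas) (W : TorusPatch N Λ), ∃ t : (Fin p.1.1.dim → ℝ) → ℝ,
      IsTropicalFunctionOn t (p.1.1.overlap (torusChart N Λ W)) ∧
        ∀ v ∈ W.1, RealTorus.mk N Λ v ∈ p.1.1.equiv.source → ∀ a : Trop,
          f (p.1.2.toOpenPartialHomeomorph.symm (RealTorus.mk N Λ v, a)) =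
            D.toTotal (v, a + (t (p.1.1.equiv (RealTorus.mk N Λ v)) : Trop)) := by
    intro p W
    obtain ⟨t, h1, h2⟩ := ht p.1 p.2 (torusChart N Λ W, D.triv W) ⟨W, rfl⟩
    refine ⟨t, h1, fun v hv hvp a => ?_⟩
    have h3 := h2 (RealTorus.mk N Λ v) ⟨hvp, v, hv, rfl⟩ a
    refine (D.triv W).injOn ?_ ?_ (h3.trans (D.triv_toTotal W hv _).symm)
    · refine (D.triv W).mem_source.2 ?_
      have h4 := hf (p.1.2.toOpenPartialHomeomorph.symm (RealTorus.mk N Λ v, a))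
      rw [p.1.2.proj_symm_apply' (by rw [L.baseSet_eq _ p.2]; exact hvp)] at h4
      have h5 : D.proj (f (p.1.2.toOpenPartialHomeomorph.symm (RealTorus.mk N Λ v, a))) =
        RealTorus.mk N Λ v := h4
      rw [h5]
      exact ⟨v, hv, rfl⟩
    · refine (D.triv W).mem_source.2 ?_
      rw [D.proj_toTotal]
      exact ⟨v, hv, rfl⟩
  have hex : ∀ (p : L.atlas) (v : V), ∃ r : ℝ, RealTorus.mk N Λ v ∈ p.1.1.equiv.source →
      ∀ a : Trop, f (p.1.2.toOpenPartialHomeomorph.symm (RealTorus.mk N Λ v, a)) =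
        D.toTotal (v, a + (r : Trop)) := by
    intro p v
    obtain ⟨W, hvW⟩ := exists_torusPatch N Λ v
    obtain ⟨t, -, h⟩ := hW p W
    exact ⟨_, fun hvp a => h v hvW hvp a⟩
  choose τ hτ using hex
  have huniq : ∀ (p : L.atlas) (v : V) (r : ℝ), RealTorus.mk N Λ v ∈ p.1.1.equiv.source →
      f (p.1.2.toOpenPartialHomeomorph.symm (RealTorus.mk N Λ v, 0)) = D.toTotal (v, (r : Trop)) →
      τ p v = r := by
    intro p v r hv h
    rw [hτ p v hv 0, zero_add] at h
    exact WithTop.coe_injective (D.toTotal_inj h)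
  refine ⟨τ, ?_, ?_, ?_⟩
  · intro p v u hv
    have hmk : RealTorus.mk N Λ (v + u) = RealTorus.mk N Λ v :=
      RealTorus.mk_eq_mk.2 (by simp)
    refine huniq p _ _ (by rwa [hmk]) ?_
    rw [hmk, hτ p v hv 0]
    refine D.toTotal_eq.2 ⟨u, ?_⟩
    simp only [TropicalDescentDatum.act, zero_add, ← WithTop.coe_add]
    congr 2
    ring
  · intro p q v hv
    have hvp := hv.1
    have hvq := hv.2
    have hbp : RealTorus.mk N Λ v ∈ p.1.2.baseSet := by rw [L.baseSet_eq _ p.2]; exact hvp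
    have hbq : RealTorus.mk N Λ v ∈ q.1.2.baseSet := by rw [L.baseSet_eq _ q.2]; exact hvq
    refine huniq p v _ hvp ?_
    have h1 : p.1.2.toOpenPartialHomeomorph.symm (RealTorus.mk N Λ v, (0 : Trop)) =
        q.1.2.toOpenPartialHomeomorph.symm (RealTorus.mk N Λ v,
          (L.transitionFun p q (RealTorus.mk N Λ v) : Trop)) := by
      have h2 := L.coordChange_eq p q hv 0
      rw [zero_add] at h2
      rw [← h2]
      rw [p.1.2.mk_coordChange q.1.2 hbp hbq, ← q.1.2.coe_coe, q.1.2.left_inv]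
      rw [q.1.2.mem_source, p.1.2.proj_symm_apply' hbp]
      exact hbq
    rw [h1, hτ q v hvq, ← WithTop.coe_add]
  · intro p W
    obtain ⟨t, h1, h2⟩ := hW p W
    refine ⟨t, h1, fun v hv hvp => huniq p v _ hvp ?_⟩
    rw [h2 v hv hvp, zero_add]

/-- The functions on `V` that represent nontrivial regular sections of `d L(λ, γ)`. -/
structure IsThetaFunction (D : TropicalDescentDatum N Λ) (d : ℕ) (θ : V → ℝ) : Prop where
  map_add : ∀ (v : V) (u : Λ), θ (v + u) = θ v - d * (D.lam u).1 v - d * D.gam u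
  local_min : ∀ v₀ : V, ∃ S : Set (dualLattice N × ℝ), S.Finite ∧
    ∀ᶠ v in 𝓝 v₀, (∀ g ∈ S, θ v ≤ g.1.1 v + g.2) ∧ ∃ g ∈ S, θ v = g.1.1 v + g.2

/-- A theta function, expressed in the chart `c`, is up to a tropical function `t` locally the
minimum of finitely many integral affine functions. -/
theorem IsThetaFunction.exists_isMinOfForms {D : TropicalDescentDatum N Λ} {d : ℕ} {θ : V → ℝ}
    (hθ : IsThetaFunction D d θ) {c : RationalPolyhedralChart (RealTorus N Λ)}
    (hc : ∀ W, IsTropicalMorphismOn ((torusChart N Λ W).equiv ∘ c.equiv.symm)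
      (c.overlap (torusChart N Λ W))) {τ : V → ℝ}
    (hτ : ∀ W : TorusPatch N Λ, ∃ t : (Fin c.dim → ℝ) → ℝ,
        IsTropicalFunctionOn t (c.overlap (torusChart N Λ W)) ∧
          ∀ v ∈ W.1, RealTorus.mk N Λ v ∈ c.equiv.source →
            τ v = t (c.equiv (RealTorus.mk N Λ v)))
    {φ : (Fin c.dim → ℝ) → ℝ}
    (hφ : ∀ v, RealTorus.mk N Λ v ∈ c.equiv.source →
      φ (c.equiv (RealTorus.mk N Λ v)) = θ v - d * τ v)
    {y₀ : Fin c.dim → ℝ} (hy₀ : y₀ ∈ c.equiv.target) :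
    ∃ (S : Set ((Fin c.dim → ℤ) × ℝ)) (F : (Fin c.dim → ℝ) → ℝ), S.Finite ∧
      IsMinOfForms (fun g : S => g.1) F univ ∧ φ =ᶠ[𝓝[c.equiv.target] y₀] F := by
  obtain ⟨v₀, hv₀⟩ := RealTorus.exists_mk_eq (c.equiv.symm y₀)
  obtain ⟨W, hvW⟩ := exists_torusPatch N Λ v₀
  obtain ⟨t, ht, hτt⟩ := hτ W
  have hy₀W : c.equiv.symm y₀ ∈ (torusChart N Λ W).equiv.source := ⟨v₀, hvW, hv₀⟩
  have hov := c.overlap_mem_nhdsWithin (torusChart N Λ W) hy₀ hy₀W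
  have hy₀o : y₀ ∈ c.overlap (torusChart N Λ W) :=
    ⟨_, ⟨c.equiv.map_target hy₀, hy₀W⟩, c.equiv.right_inv hy₀⟩
  obtain ⟨A, hA, hAe⟩ := hc W y₀ hy₀o
  obtain ⟨T, hT, hTe⟩ := ht y₀ hy₀o
  have hA0 : (latticeCoord N).symm (A y₀) = v₀ := by
    rw [← hAe.self_of_nhdsWithin hy₀o, Function.comp_apply, ← hv₀, torusChart_mk N Λ W hvW]
    exact (latticeCoord N).symm_apply_apply v₀
  obtain ⟨S, hS, hSe⟩ := hθ.local_min v₀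
  have hcont : Continuous fun y => (latticeCoord N).symm (A y) :=
    (latticeCoord N).symm.continuous.comp hA.continuous
  have hSe' : ∀ᶠ y in 𝓝 y₀, (∀ g ∈ S, θ ((latticeCoord N).symm (A y)) ≤
      g.1.1 ((latticeCoord N).symm (A y)) + g.2) ∧ ∃ g ∈ S,
      θ ((latticeCoord N).symm (A y)) = g.1.1 ((latticeCoord N).symm (A y)) + g.2 := by
    have h1 := hcont.tendsto y₀
    rw [hA0] at h1
    exact h1.eventually hSe
  -- `A` is the change of charts and `T` the local form of `τ`. Pulling back along `A` and
  -- subtracting `d T` keeps forms integral affine and does not affect which one is minimal.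
  have hforms : ∀ g : dualLattice N × ℝ, ∃ h : (Fin c.dim → ℤ) × ℝ, ∀ y,
      g.1.1 ((latticeCoord N).symm (A y)) + g.2 - d * T y = affEval h y := fun g =>
    (((isZAffineFunction_comp_latticeCoord g.1 g.2).comp hA).sub_nat_mul hT d).exists_affEval
  choose G hG using hforms
  have hSne : S.Nonempty := by
    obtain ⟨-, g, hg, -⟩ := hSe.self_of_nhds
    exact ⟨g, hg⟩
  have : Finite (G '' S) := (hS.image G).to_subtype
  have : Nonempty (G '' S) := (hSne.image G).to_subtype
  obtain ⟨F, hF⟩ := _root_.exists_isMinOfForms fun g : G '' S => g.1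
  refine ⟨G '' S, F, hS.image G, hF, ?_⟩
  filter_upwards [nhdsWithin_le_of_mem hov hAe, nhdsWithin_le_of_mem hov hTe, hov,
    nhdsWithin_le_nhds hSe'] with y h1 h2 h3 h4
  obtain ⟨x, ⟨hxc, v, hvW', rfl⟩, rfl⟩ := h3
  have h5 : (latticeCoord N).symm (A (c.equiv (RealTorus.mk N Λ v))) = v := by
    rw [← h1, Function.comp_apply, c.equiv.left_inv hxc, torusChart_mk N Λ W hvW']
    exact (latticeCoord N).symm_apply_apply v
  rw [h5] at h4
  obtain ⟨hle, g, hg, hge⟩ := h4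
  rw [hφ v hxc, hτt v hvW' hxc, h2]
  obtain ⟨hFle, ⟨_, g', hg', rfl⟩, hFe⟩ := hF (c.equiv (RealTorus.mk N Λ v)) (mem_univ _)
  have e1 := hG g (c.equiv (RealTorus.mk N Λ v))
  have e2 := hG g' (c.equiv (RealTorus.mk N Λ v))
  rw [h5] at e1 e2
  have e3 := hFle ⟨_, g, hg, rfl⟩
  have e4 := hle g' hg'
  simp only at e3 hFe
  apply le_antisymm <;> linarith

/-- A theta function gives a nontrivial regular section of `dL`. -/
theorem IsThetaFunction.exists_section {L : TropicalLineBundle.{u, v} (RealTorus N Λ)}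
    {D : TropicalDescentDatum N Λ} {d : ℕ} {τ : L.atlas → V → ℝ}
    (hτ₁ : ∀ (p : L.atlas) (v : V) (u : Λ), RealTorus.mk N Λ v ∈ p.1.1.equiv.source →
        τ p (v + u) = τ p v - (D.lam u).1 v - D.gam u)
    (hτ₂ : ∀ (p q : L.atlas) (v : V),
      RealTorus.mk N Λ v ∈ p.1.1.equiv.source ∩ q.1.1.equiv.source →
        τ p v = L.transitionFun p q (RealTorus.mk N Λ v) + τ q v)
    (hτ₃ : ∀ (p : L.atlas) (W : TorusPatch N Λ), ∃ t : (Fin p.1.1.dim → ℝ) → ℝ,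
        IsTropicalFunctionOn t (p.1.1.overlap (torusChart N Λ W)) ∧
          ∀ v ∈ W.1, RealTorus.mk N Λ v ∈ p.1.1.equiv.source →
            τ p v = t (p.1.1.equiv (RealTorus.mk N Λ v)))
    {θ : V → ℝ} (hθ : IsThetaFunction D d θ) :
    ∃ s : (L.multiple d).NontrivialRegularSection, ∀ (p : L.atlas) (v : V),
      RealTorus.mk N Λ v ∈ p.1.1.equiv.source →
        s.1.value (p.1.1, (L.multipleCore d).localTriv p) (RealTorus.mk N Λ v) =
          ((θ v - d * τ p v : ℝ) : Trop) := by
  choose r hr using RealTorus.exists_mk_eq (N := N) (Λ := Λ)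
  -- The fibre coordinate at `x` refers to the trivialization `indexAt x` and is computed at an
  -- arbitrary lift `r x`. Independence of the lift is `hinv`; the change of trivialization is `hτ₂`
  -- multiplied by `d`.
  let σ : (L.multiple d).GlobalSection :=
    { toFun := fun x => Bundle.TotalSpace.mk (F := Trop) (E := (L.multipleCore d).Fiber) x
        ((θ (r x) - d * τ ((L.multipleCore d).indexAt x) (r x) : ℝ) : Trop)
      proj_toFun := fun x => rfl }
  have hinv : ∀ (p : L.atlas) (v w : V), RealTorus.mk N Λ v ∈ p.1.1.equiv.source →
      RealTorus.mk N Λ v = RealTorus.mk N Λ w → θ w - d * τ p w = θ v - d * τ p v := by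
    intro p v w hv hvw
    have h1 := hτ₁ p v ⟨_, RealTorus.mk_eq_mk.1 hvw⟩ hv
    have h2 := hθ.map_add v ⟨_, RealTorus.mk_eq_mk.1 hvw⟩
    simp only [add_sub_cancel] at h1 h2
    rw [h1, h2]
    ring
  have hval : ∀ (p : L.atlas) (v : V), RealTorus.mk N Λ v ∈ p.1.1.equiv.source →
      σ.value (p.1.1, (L.multipleCore d).localTriv p) (RealTorus.mk N Λ v) =
        ((θ v - d * τ p v : ℝ) : Trop) := by
    intro p v hv
    set x := RealTorus.mk N Λ v with hx
    have hx2 : x ∈ ((L.multipleCore d).indexAt x).1.1.equiv.source :=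
      (L.multipleCore d).mem_baseSet_at x
    have h1 : σ.value (p.1.1, (L.multipleCore d).localTriv p) x =
        ((θ (r x) - d * τ ((L.multipleCore d).indexAt x) (r x) : ℝ) : Trop) +
          ((d * L.transitionFun ((L.multipleCore d).indexAt x) p x : ℝ) : Trop) := rfl
    have h2 := hτ₂ ((L.multipleCore d).indexAt x) p (r x) (by rw [hr]; exact ⟨hx2, hv⟩)
    rw [hr] at h2
    rw [h1, h2, ← WithTop.coe_add, ← hinv p v (r x) hv (hr x).symm]
    congr 1
    ring
  have hreg : ∀ p : L.atlas, ∃ φ : (Fin p.1.1.dim → ℝ) → ℝ,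
      (∀ y ∈ p.1.1.equiv.target,
        (((L.multipleCore d).localTriv p) (σ.toFun (p.1.1.equiv.symm y))).2 = (φ y : Trop)) ∧
        IsLocallyConcaveOn φ p.1.1.equiv.target ∧ IsPiecewiseZAffineOn φ p.1.1.equiv.target := by
    intro p
    refine ⟨fun y => θ (r (p.1.1.equiv.symm y)) - d * τ p (r (p.1.1.equiv.symm y)), ?_, ?_⟩
    · intro y hy
      have h1 := hval p (r (p.1.1.equiv.symm y)) (by rw [hr]; exact p.1.1.equiv.map_target hy)
      rw [hr] at h1
      exact h1
    · refine isLocallyConcaveOn_and_isPiecewiseZAffineOn fun y hy => ?_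
      refine hθ.exists_isMinOfForms (fun W => ?_) (hτ₃ p) (fun v hv => ?_) hy
      · exact L.isAtlasOf.2.compatible _ (Or.inl ⟨p.1, p.2, rfl⟩) _ (Or.inr ⟨W, rfl⟩)
      · simp only [p.1.1.equiv.left_inv hv]
        exact hinv p v _ hv (hr _).symm
  refine ⟨⟨σ, Or.inr ?_, ?_⟩, hval⟩
  · rintro _ ⟨p, rfl⟩
    exact hreg p
  · intro htriv
    obtain ⟨p, hp, hx⟩ := L.exists_mem_atlas (RealTorus.mk N Λ 0)
    obtain ⟨φ, hφ, -⟩ := hreg ⟨p, hp⟩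
    have h1 := htriv _ ⟨⟨p, hp⟩, rfl⟩ _ (p.1.equiv.map_source hx)
    have h2 := hφ _ (p.1.equiv.map_source hx)
    exact WithTop.coe_ne_top (h2.symm.trans h1)

/-- Finitely many theta functions give sections of `dL` whose map to projective space is given by
the differences of the theta functions. -/
theorem exists_sectionMap_eq {L : TropicalLineBundle.{u, v} (RealTorus N Λ)}
    {D : TropicalDescentDatum N Λ} (hL : L.IsIsomorphic D.lineBundle) {d k : ℕ}
    {θ : Fin (k + 1) → V → ℝ} (hθ : ∀ i, IsThetaFunction D d (θ i)) :
    ∃ s : Fin (k + 1) → (L.multiple d).NontrivialRegularSection, ∀ v,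
      TropicalLineBundle.sectionMap s (RealTorus.mk N Λ v) =
        TropProj.ofReal fun i => θ i.succ v - θ 0 v := by
  obtain ⟨τ, h1, h2, h3⟩ := exists_isomorphism_cocycle hL
  choose s hs using fun i => (hθ i).exists_section h1 h2 h3
  refine ⟨s, fun v => ?_⟩
  obtain ⟨p, hp, hx⟩ := L.exists_mem_atlas (RealTorus.mk N Λ v)
  rw [TropicalLineBundle.sectionMap_eq s (p := (p.1, (L.multipleCore d).localTriv ⟨p, hp⟩))
    ⟨⟨p, hp⟩, rfl⟩ hx]
  -- Subtracting the zeroth coordinate normalizes it to `0` and removes the local term `d τ`, which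
  -- all the coordinates share.
  refine Quotient.sound ⟨-(θ 0 v - d * τ ⟨p, hp⟩ v), fun i => ?_⟩
  have h4 := hs i ⟨p, hp⟩ v hx
  simp only [h4, ← WithTop.coe_add]
  congr 1
  refine Fin.cases ?_ (fun i => ?_) i
  · simp
  · simp only [Fin.cons_succ]
    ring

end Sections

/-! ### Embeddings into tropical projective space -/

/-- The function `a ↦ exp (-a)` on `𝕋`. -/
noncomputable def Trop.expNeg (a : Trop) : ℝ :=
  WithTop.recTopCoe (C := fun _ => ℝ) 0 (fun r => Real.exp (-r)) a

theorem Trop.expNeg_top : Trop.expNeg ⊤ = 0 := rfl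

theorem Trop.expNeg_coe (r : ℝ) : Trop.expNeg (r : Trop) = Real.exp (-r) := rfl

theorem Trop.expNeg_nonneg (a : Trop) : 0 ≤ Trop.expNeg a := by
  induction a using WithTop.recTopCoe with
  | top => exact le_rfl
  | coe r => exact (Real.exp_pos _).le

theorem Trop.expNeg_add (c : ℝ) (a : Trop) :
    Trop.expNeg ((c : Trop) + a) = Real.exp (-c) * Trop.expNeg a := by
  induction a using WithTop.recTopCoe with
  | top => rw [WithTop.add_top, Trop.expNeg_top, mul_zero]
  | coe r => rw [← WithTop.coe_add, Trop.expNeg_coe, Trop.expNeg_coe, ← Real.exp_add, neg_add]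

/-- The negative of the function is strictly increasing with range `(-∞, 0]`; a strictly monotone
map with order-connected range is an embedding for the order topologies. -/
theorem Trop.continuous_expNeg : Continuous Trop.expNeg := by
  have hm : StrictMono fun a : Trop => -Trop.expNeg a := by
    intro a b hab
    induction a using WithTop.recTopCoe with
    | top => exact absurd hab not_top_lt
    | coe r =>
      induction b using WithTop.recTopCoe with
      | top =>
        simp only [Trop.expNeg_top, Trop.expNeg_coe, neg_zero, neg_lt_zero]
        exact Real.exp_pos _
      | coe s =>
        have : r < s := WithTop.coe_lt_coe.1 hab
        simp only [Trop.expNeg_coe, neg_lt_neg_iff, Real.exp_lt_exp]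
        exact this
  have hr : (range fun a : Trop => -Trop.expNeg a) = Iic 0 := by
    ext y
    constructor
    · rintro ⟨a, rfl⟩
      exact neg_nonpos.2 (Trop.expNeg_nonneg a)
    · intro hy
      rcases (show y ≤ 0 from hy).lt_or_eq with h | h
      · refine ⟨((-Real.log (-y) : ℝ) : Trop), ?_⟩
        simp only [Trop.expNeg_coe, neg_neg]
        rw [Real.exp_log (by linarith), neg_neg]
      · exact ⟨⊤, by rw [h]; exact neg_zero⟩
  have hc := (hm.isEmbedding_of_ordConnected (hr ▸ ordConnected_Iic)).continuous
  exact hc.neg.congr fun a => neg_neg _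

theorem TropVector.sum_expNeg_pos {k : ℕ} (a : TropVector k) : 0 < ∑ j, Trop.expNeg (a.1 j) := by
  obtain ⟨i, hi⟩ := a.2
  refine Finset.sum_pos' (fun j _ => Trop.expNeg_nonneg _) ⟨i, Finset.mem_univ _, ?_⟩
  obtain ⟨r, hr⟩ := WithTop.ne_top_iff_exists.1 hi
  rw [← hr, Trop.expNeg_coe]
  exact Real.exp_pos _

/-- The map `(a_0 : ⋯ : a_k) ↦ (exp (-a_i) / ∑ j, exp (-a_j))` from tropical projective space to
the standard simplex. -/
noncomputable def TropProj.toSimplex {k : ℕ} : TropProj k → Fin (k + 1) → ℝ :=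
  Quotient.lift (fun a : TropVector k => fun i => Trop.expNeg (a.1 i) / ∑ j, Trop.expNeg (a.1 j)) (by
    rintro a b ⟨c, hc⟩
    ext i
    simp only [hc, Trop.expNeg_add, ← Finset.mul_sum]
    rw [mul_div_mul_left _ _ (Real.exp_pos _).ne'])

theorem TropProj.continuous_toSimplex {k : ℕ} : Continuous (TropProj.toSimplex (k := k)) := by
  refine continuous_quot_lift _ (continuous_pi fun i => ?_)
  have h : ∀ j, Continuous fun a : TropVector k => Trop.expNeg (a.1 j) := fun j =>
    Trop.continuous_expNeg.comp ((continuous_apply j).comp continuous_subtype_val)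
  exact (h i).div (continuous_finsetSum _ fun j _ => h j) fun a => (a.sum_expNeg_pos).ne'

theorem TropProj.toSimplex_ofReal {k : ℕ} (a : Fin k → ℝ) (i : Fin (k + 1)) :
    (TropProj.ofReal a).toSimplex i = Real.exp (-(Fin.cons 0 a : Fin (k + 1) → ℝ) i) /
      ∑ j, Real.exp (-(Fin.cons 0 a : Fin (k + 1) → ℝ) j) := rfl

theorem TropProj.continuous_ofReal {k : ℕ} : Continuous (TropProj.ofReal (k := k)) := by
  refine continuous_quot_mk.comp (Continuous.subtype_mk (continuous_pi fun i => ?_) _)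
  refine Trop.continuous_coe.comp ?_
  refine Fin.cases ?_ (fun i => ?_) i
  · simpa using continuous_const
  · simpa using continuous_apply i

/-- The zeroth coordinate is the inverse of the common denominator, after which the others recover
`exp (-a_i)`. -/
theorem TropProj.toSimplex_ofReal_injective {k : ℕ} :
    Function.Injective fun a : Fin k → ℝ => (TropProj.ofReal a).toSimplex := by
  intro a b hab
  have h := congrFun hab
  simp only [TropProj.toSimplex_ofReal] at h
  have hpos : ∀ a : Fin k → ℝ, 0 < ∑ j, Real.exp (-(Fin.cons 0 a : Fin (k + 1) → ℝ) j) := fun a =>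
    Finset.sum_pos (fun j _ => Real.exp_pos _) Finset.univ_nonempty
  have h0 := h 0
  simp only [Fin.cons_zero, neg_zero, Real.exp_zero] at h0
  rw [one_div, one_div, inv_inj] at h0
  ext i
  have hi := h i.succ
  simp only [Fin.cons_succ] at hi
  rw [h0, div_left_inj' (hpos b).ne', Real.exp_eq_exp, neg_inj] at hi
  exact hi

/-- Followed by the map to the simplex, this is a continuous injection of a compact space into a
Hausdorff one, hence an embedding; then so is its first factor. No separation property of `TP^k` is
needed. -/
theorem TropProj.isEmbedding_ofReal_comp {X : Type*} [TopologicalSpace X] [CompactSpace X] {k : ℕ}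
    {ψ : X → Fin k → ℝ} (hc : Continuous ψ) (hi : Function.Injective ψ) :
    IsEmbedding fun x => TropProj.ofReal (ψ x) := by
  refine IsEmbedding.of_comp (TropProj.continuous_ofReal.comp hc) TropProj.continuous_toSimplex ?_
  exact ((TropProj.continuous_toSimplex.comp (TropProj.continuous_ofReal.comp hc)).isClosedEmbedding
    (TropProj.toSimplex_ofReal_injective.comp hi)).isEmbedding

/-! ### Theta functions -/

section Theta

variable {V : Type u} [NormedAddCommGroup V] [NormedSpace ℝ V]

/-- The theta function of the coset `w + Λ`. -/
noncomputable def theta (Q : V →ₗ[ℝ] V →ₗ[ℝ] ℝ) (Λ : Submodule ℤ V) (d : ℕ) (e w x : V) : ℝ :=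
  d * (latMin Q Λ (x + e + w) - halfQuad Q x - Q e x)

variable {Q : V →ₗ[ℝ] V →ₗ[ℝ] ℝ} {N Λ : Submodule ℤ V}

/-- Expanding `q(x + (w + u + e))` and subtracting `q(x) + Q(e, x)` leaves `Q(w + u, x) + q(w + u +
e)`: the quadratic terms cancel and each lattice vector contributes an affine form. -/
theorem theta_le (hs : ∀ x y, Q x y = Q y x) (hp : ∀ x, x ≠ 0 → 0 < Q x x) (d : ℕ) (e w x : V)
    (u : Λ) : theta Q Λ d e w x ≤ d * Q (w + u) x + d * halfQuad Q (w + u + e) := by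
  have h := latMin_le Λ hp (x + e + w) u
  rw [show x + e + w + u = x + (w + u + e) by abel, halfQuad_add hs] at h
  rw [theta, ← mul_add]
  refine mul_le_mul_of_nonneg_left ?_ (Nat.cast_nonneg d)
  rw [map_add, hs x e, hs x] at h
  linarith

theorem theta_eq (hs : ∀ x y, Q x y = Q y x) (hp : ∀ x, x ≠ 0 → 0 < Q x x) (d : ℕ) (e w x : V)
    {u : Λ} (hu : ∀ u' : Λ, halfQuad Q (x + e + w + u) ≤ halfQuad Q (x + e + w + u')) :
    theta Q Λ d e w x = d * Q (w + u) x + d * halfQuad Q (w + u + e) := by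
  have h := latMin_eq Λ hp hu
  rw [show x + e + w + u = x + (w + u + e) by abel, halfQuad_add hs] at h
  rw [theta, ← mul_add, h, map_add, hs x e, hs x]
  ring

theorem theta_add (hs : ∀ x y, Q x y = Q y x) (d : ℕ) (e w x : V) (u : Λ) :
    theta Q Λ d e w (x + u) =
      theta Q Λ d e w x - d * Q u x - d * (halfQuad Q (u : V) + Q e u) := by
  have h : latMin Q Λ (x + u + e + w) = latMin Q Λ (x + e + w) := by
    rw [← latMin_add Λ (x + e + w) u]
    congr 1
    abel
  rw [theta, theta, h, halfQuad_add hs, map_add, hs x u]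
  ring

theorem lam_eq_of_polarization [DiscreteTopology Λ] [IsZLattice ℝ Λ] {lam : Λ →+ dualLattice N}
    (hQ : ∀ u v : Λ, Q u v = (lam u).1 v) (u : Λ) : (lam u).1 = Q u := by
  refine LinearMap.ext_on (IsZLattice.span_top (K := ℝ) (L := Λ)) fun v hv => ?_
  exact (hQ u ⟨v, hv⟩).symm

theorem smul_add_mem_dualLattice {lam : Λ →+ dualLattice N} (hlam : ∀ u : Λ, (lam u).1 = Q u)
    {d : ℕ} {w : V} (hw : (d : ℝ) • Q w ∈ dualLattice N) (u : Λ) :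
    (d : ℝ) • Q (w + u) ∈ dualLattice N := by
  rw [map_add, smul_add]
  refine add_mem hw ?_
  rw [← hlam u, Nat.cast_smul_eq_nsmul]
  exact nsmul_mem (lam u).2 d

/-- The affine functions whose minimum is the theta function. -/
noncomputable def thetaForm {lam : Λ →+ dualLattice N} (hlam : ∀ u : Λ, (lam u).1 = Q u)
    {d : ℕ} {w : V} (hw : (d : ℝ) • Q w ∈ dualLattice N) (e : V) (u : Λ) : dualLattice N × ℝ :=
  (⟨_, smul_add_mem_dualLattice hlam hw u⟩, d * halfQuad Q (w + u + e))

variable [FiniteDimensional ℝ V]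

/-- Near any point a single finite set of lattice vectors contains the minimizers for all the
cosets, so the theta functions are there minima of finitely many forms. -/
theorem exists_finset_minimizers_mem [DiscreteTopology Λ] (hp : ∀ x, x ≠ 0 → 0 < Q x x)
    {κ : Type*} [Finite κ] (e : V) (w : κ → V) (v₀ : V) :
    ∃ T : Finset Λ, ∀ x ∈ Metric.ball v₀ 1, ∀ s, ∀ u : Λ,
      (∀ u' : Λ, halfQuad Q (x + e + w s + u) ≤ halfQuad Q (x + e + w s + u')) → u ∈ T := by
  classical
  cases nonempty_fintype κ
  choose T hT0 hT using fun s => exists_finset_halfQuad_lt Λ hp (1 + ‖v₀ + e + w s‖)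
  refine ⟨Finset.univ.biUnion T, fun x hx s u hu => ?_⟩
  refine Finset.mem_biUnion.2 ⟨s, Finset.mem_univ _, ?_⟩
  by_contra hcon
  have h1 : ‖x + e + w s‖ ≤ 1 + ‖v₀ + e + w s‖ := by
    rw [show x + e + w s = (x - v₀) + (v₀ + e + w s) by abel]
    rw [Metric.mem_ball, dist_eq_norm] at hx
    exact (norm_add_le _ _).trans (by linarith)
  have h2 := hT s _ h1 u hcon
  have h3 := hu 0
  simp only [ZeroMemClass.coe_zero, add_zero] at h3
  linarith

/-- The function `γ` of a descent datum is the sum of half the quadratic form and a linear form. -/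
theorem exists_gam_eq [DiscreteTopology Λ] [IsZLattice ℝ Λ] (D : TropicalDescentDatum N Λ)
    (hQ : ∀ u v : Λ, Q u v = (D.lam u).1 v) (hs : ∀ x y, Q x y = Q y x)
    (hsurj : Function.Surjective Q) :
    ∃ e : V, ∀ u : Λ, D.gam u = halfQuad Q (u : V) + Q e u := by
  have : Module.Finite ℤ Λ := ZLattice.module_finite ℝ Λ
  have : Module.Free ℤ Λ := ZLattice.module_free ℝ Λ
  -- The descent condition on `γ` is the identity `q(a + b) - q(a) - q(b) = Q(a, b)`, so the
  -- difference is additive.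
  let ℓ : Λ →+ ℝ := AddMonoidHom.mk' (fun u => D.gam u - halfQuad Q (u : V)) fun a b => by
    have h := D.gam_add a b
    rw [← hQ, hs] at h
    rw [Submodule.coe_add, halfQuad_add hs]
    linarith
  let b := Module.finBasis ℤ Λ
  obtain ⟨e, he⟩ := hsurj ((b.ofZLatticeBasis ℝ Λ).constr ℝ fun i => ℓ (b i))
  have h1 : ((Q e).toAddMonoidHom.comp Λ.subtype.toAddMonoidHom).toIntLinearMap =
      ℓ.toIntLinearMap := by
    refine b.ext fun i => ?_
    have h2 : Q e (b i : V) = ℓ (b i) := by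
      rw [he, ← b.ofZLatticeBasis_apply ℝ Λ, Module.Basis.constr_basis]
    exact h2
  refine ⟨e, fun u => ?_⟩
  have h3 : Q e u = D.gam u - halfQuad Q (u : V) := LinearMap.congr_fun h1 u
  rw [h3]
  ring

theorem surjective_of_posDef (hp : ∀ x, x ≠ 0 → 0 < Q x x) : Function.Surjective Q := by
  have hinj : Function.Injective Q := by
    refine (injective_iff_map_eq_zero Q).2 fun x hx => ?_
    by_contra hne
    have := hp x hne
    rw [hx] at this
    simp at this
  exact (LinearMap.injective_iff_surjective_of_finrank_eq_finrank
    (Subspace.dual_finrank_eq (K := ℝ) (V := V)).symm).1 hinj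

theorem isThetaFunction_theta [DiscreteTopology N] [IsZLattice ℝ N] [DiscreteTopology Λ]
    (D : TropicalDescentDatum N Λ) (hlam : ∀ u : Λ, (D.lam u).1 = Q u)
    (hs : ∀ x y, Q x y = Q y x) (hp : ∀ x, x ≠ 0 → 0 < Q x x) {e : V}
    (he : ∀ u : Λ, D.gam u = halfQuad Q (u : V) + Q e u) {d : ℕ} {w : V}
    (hw : (d : ℝ) • Q w ∈ dualLattice N) : IsThetaFunction D d (theta Q Λ d e w) := by
  refine ⟨fun v u => ?_, fun v₀ => ?_⟩
  · rw [theta_add hs, he, hlam]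
  · obtain ⟨T, hT⟩ := exists_finset_minimizers_mem (Λ := Λ) hp e (fun _ : Unit => w) v₀
    refine ⟨thetaForm hlam hw e '' (T : Set Λ), T.finite_toSet.image _, ?_⟩
    filter_upwards [Metric.ball_mem_nhds v₀ one_pos] with v hv
    refine ⟨?_, ?_⟩
    · rintro _ ⟨u, -, rfl⟩
      exact theta_le hs hp d e w v u
    · obtain ⟨u, hu⟩ := exists_forall_halfQuad_le Λ hp (v + e + w)
      exact ⟨_, ⟨u, hT v hv () u hu, rfl⟩, theta_eq hs hp d e w v hu⟩

theorem IsThetaFunction.continuous [DiscreteTopology N] [IsZLattice ℝ N] [DiscreteTopology Λ]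
    {D : TropicalDescentDatum N Λ} {d : ℕ} {θ : V → ℝ} (hθ : IsThetaFunction D d θ) :
    Continuous θ := by
  refine continuous_iff_continuousAt.2 fun v₀ => ?_
  obtain ⟨S, hS, hSe⟩ := hθ.local_min v₀
  have hne : hS.toFinset.Nonempty := by
    obtain ⟨-, g, hg, -⟩ := hSe.self_of_nhds
    exact ⟨g, hS.mem_toFinset.2 hg⟩
  have hc : Continuous fun v => hS.toFinset.inf' hne fun g : dualLattice N × ℝ => g.1.1 v + g.2 :=
    Continuous.finset_inf'_apply hne fun g _ =>
      (LinearMap.continuous_of_finiteDimensional g.1.1).add continuous_const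
  refine hc.continuousAt.congr ?_
  filter_upwards [hSe] with v hv
  obtain ⟨hle, g, hg, hge⟩ := hv
  refine le_antisymm ?_ ?_
  · rw [hge]
    exact Finset.inf'_le _ (hS.mem_toFinset.2 hg)
  · exact Finset.le_inf' _ _ fun g' hg' => hle g' (hS.mem_toFinset.1 hg')

end Theta

/-! ### Unimodularity, separation of points and the embedding theorem -/

section Main

variable {V : Type u} [NormedAddCommGroup V] [NormedSpace ℝ V] [FiniteDimensional ℝ V]

theorem dualLattice.exists_coeff {N : Submodule ℤ V} [DiscreteTopology N] [IsZLattice ℝ N]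
    (f : dualLattice N) : ∃ a : Fin (Module.finrank ℤ N) → ℤ,
      ∀ i, (a i : ℝ) = f.1 (latticeBasis N i) := by
  choose a ha using fun i => f.2 (latticeBasis N i) (latticeBasis_mem N i)
  exact ⟨a, fun i => (ha i).symm⟩

/-- The coordinates of an integral linear form. -/
noncomputable def dualLattice.coeff {N : Submodule ℤ V} [DiscreteTopology N] [IsZLattice ℝ N]
    (f : dualLattice N) : Fin (Module.finrank ℤ N) → ℤ := (dualLattice.exists_coeff f).choose

theorem dualLattice.coeff_apply {N : Submodule ℤ V} [DiscreteTopology N] [IsZLattice ℝ N]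
    (f : dualLattice N) (i : Fin (Module.finrank ℤ N)) :
    (dualLattice.coeff f i : ℝ) = f.1 (latticeBasis N i) :=
  (dualLattice.exists_coeff f).choose_spec i

theorem affEval_coeff {N : Submodule ℤ V} [DiscreteTopology N] [IsZLattice ℝ N]
    (f : dualLattice N) (r : ℝ) (y : Fin (Module.finrank ℤ N) → ℝ) :
    affEval (dualLattice.coeff f, r) y = f.1 ((latticeCoord N).symm y) + r := by
  have h : (latticeCoord N).symm y = ∑ i, y i • latticeBasis N i :=
    (latticeBasis N).equivFun_symm_apply y
  simp only [affEval, dualLattice.coeff_apply, h, map_sum, map_smul, smul_eq_mul, mul_comm]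

theorem RealTorus.compactSpace (N Λ : Submodule ℤ V) [DiscreteTopology Λ] [IsZLattice ℝ Λ] :
    CompactSpace (RealTorus N Λ) := by
  obtain ⟨R, hR⟩ := exists_forall_exists_norm_add_le Λ
  have h := (isCompact_closedBall (0 : V) R).image (RealTorus.continuous_mk N Λ)
  refine ⟨h.of_isClosed_subset isClosed_univ fun x _ => ?_⟩
  obtain ⟨v, rfl⟩ := x.exists_mk_eq
  obtain ⟨u, hu⟩ := hR v
  exact ⟨v + u, by simpa using hu, RealTorus.mk_eq_mk.2 (by simp)⟩

variable {Q : V →ₗ[ℝ] V →ₗ[ℝ] ℝ} {N Λ : Submodule ℤ V}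

/-- If all cosets of `Λ` in `d⁻¹ Λ` are among those of the vectors `w r` and the basis dual to that
of `N` is among the forms `d Q(w r, ·)`, then the map given by the differences of the corresponding
theta functions is unimodular. -/
theorem isUnimodularMap_theta [DiscreteTopology N] [IsZLattice ℝ N] [DiscreteTopology Λ]
    [IsZLattice ℝ Λ] {lam : Λ →+ dualLattice N} (hlam : ∀ u : Λ, (lam u).1 = Q u)
    (hs : ∀ x y, Q x y = Q y x) (hp : ∀ x, x ≠ 0 → 0 < Q x x) (e : V) {d k : ℕ} (hd : 2 ≤ d)
    {w : Fin (k + 1) → V} (hw : ∀ r, (d : ℝ) • Q (w r) ∈ dualLattice N)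
    (hwΛ : ∀ v : Λ, ∃ r, (d : ℝ)⁻¹ • (v : V) - w r ∈ Λ)
    (hwN : ∀ i, ∃ r, ∀ j, d * Q (w r) (latticeBasis N j) = if j = i then 1 else 0)
    {ψ : RealTorus N Λ → Fin k → ℝ}
    (hψ : ∀ v, ψ (RealTorus.mk N Λ v) =
      fun i => theta Q Λ d e (w i.succ) v - theta Q Λ d e (w 0) v) :
    IsUnimodularMap ψ := by
  -- Charts on small convex patches: boundedness leaves finitely many minimizing lattice vectors,
  -- and convexity allows the cells of the arrangement to be cut down to the patch.
  refine ⟨{c | ∃ W : TorusPatch N Λ, (∃ v₀, v₀ ∈ W.1 ∧ W.1 ⊆ Metric.ball v₀ 1) ∧ Convex ℝ W.1 ∧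
    c = torusChart N Λ W}, ?_, ?_⟩
  · have hsub : {c | ∃ W : TorusPatch N Λ, (∃ v₀, v₀ ∈ W.1 ∧ W.1 ⊆ Metric.ball v₀ 1) ∧
        Convex ℝ W.1 ∧ c = torusChart N Λ W} ⊆ range (torusChart N Λ) := by
      rintro _ ⟨W, -, -, rfl⟩
      exact ⟨W, rfl⟩
    refine ⟨⟨fun x => ?_, fun c hc c' hc' => ?_⟩, ?_⟩
    · obtain ⟨v, rfl⟩ := x.exists_mk_eq
      obtain ⟨W, hW⟩ := exists_torusPatch N Λ v
      obtain ⟨ε, hε, hball⟩ := Metric.isOpen_iff.1 W.2.1 v hW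
      have hmin : 0 < min ε 1 := lt_min hε one_pos
      refine ⟨_, ⟨⟨Metric.ball v (min ε 1), Metric.isOpen_ball, W.2.2.mono
        ((Metric.ball_subset_ball (min_le_left _ _)).trans hball)⟩,
        ⟨v, Metric.mem_ball_self hmin, Metric.ball_subset_ball (min_le_right _ _)⟩,
        convex_ball _ _, rfl⟩, ?_⟩
      exact ⟨v, Metric.mem_ball_self hmin, rfl⟩
    · exact (torus_isAtlas N Λ).compatible c (hsub hc) c' (hsub hc')
    · rw [union_eq_self_of_subset_left (by exact hsub)]
      exact torus_isAtlas N Λ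
  rintro _ ⟨W, ⟨v₀, hv₀, hball⟩, hconv, rfl⟩
  obtain ⟨T, hT⟩ := exists_finset_minimizers_mem (Λ := Λ) hp e w v₀
  have htarget : (torusChart N Λ W).equiv.target = (latticeCoord N).symm ⁻¹' W.1 := rfl
  set G : Fin (k + 1) → T → (Fin (Module.finrank ℤ N) → ℤ) × ℝ := fun s u =>
    (dualLattice.coeff (thetaForm hlam (hw s) e u).1, (thetaForm hlam (hw s) e u).2) with hG
  have hGeval : ∀ s (u : T) y, affEval (G s u) y =
      d * Q (w s + u.1) ((latticeCoord N).symm y) + d * halfQuad Q (w s + u.1 + e) := fun s u y =>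
    affEval_coeff _ _ _
  have hmain := isUnimodularOn_of_isMinOfForms (G := G)
    (F := fun s y => theta Q Λ d e (w s) ((latticeCoord N).symm y))
    (U := (latticeCoord N).symm ⁻¹' W.1) (W.2.1.preimage (latticeCoord N).symm.continuous)
    (hconv.linear_preimage (latticeCoord N).symm.toLinearEquiv.toLinearMap)
    ⟨latticeCoord N v₀, by simpa using hv₀⟩ ?_ ?_
  · rw [htarget]
    have hψ' : ψ ∘ (torusChart N Λ W).equiv.symm = fun y (s : Fin k) =>
        theta Q Λ d e (w s.succ) ((latticeCoord N).symm y) -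
          theta Q Λ d e (w 0) ((latticeCoord N).symm y) :=
      funext fun y => hψ ((latticeCoord N).symm y)
    rw [hψ']
    exact hmain
  · intro s y hy
    refine ⟨fun u => ?_, ?_⟩
    · rw [hGeval]
      exact theta_le hs hp d e (w s) _ u.1
    · obtain ⟨u, hu⟩ := exists_forall_halfQuad_le Λ hp ((latticeCoord N).symm y + e + w s)
      refine ⟨⟨u, hT _ (hball hy) s u hu⟩, ?_⟩
      rw [hGeval]
      exact theta_eq hs hp d e (w s) _ hu
  · intro y hy
    obtain ⟨u, hu, hgen⟩ := exists_minimizers_generate Λ hs hp hd hwΛ ((latticeCoord N).symm y + e)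
    refine ⟨fun s => ⟨u s, hT _ (hball hy) s _ (hu s)⟩, fun s => ?_, ?_⟩
    · rw [hGeval]
      exact theta_eq hs hp d e (w s) _ (hu s)
    set rows : Fin k → Fin (Module.finrank ℤ N) → ℤ := fun s =>
      (G s.succ ⟨u s.succ, hT _ (hball hy) s.succ _ (hu s.succ)⟩).1 -
        (G 0 ⟨u 0, hT _ (hball hy) 0 _ (hu 0)⟩).1 with hrows
    -- The row span carried back to `V`: the vectors `x` for which the coordinates of `d Q(x, ·)`
    -- form an integral vector in the span. It contains the differences of the minimizers, hence by
    -- `hgen` all the `w r`.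
    let H : AddSubgroup V :=
      { carrier := {x | ∃ z ∈ Submodule.span ℤ (range rows),
          ∀ j, (z j : ℝ) = d * Q x (latticeBasis N j)}
        zero_mem' := ⟨0, zero_mem _, by simp⟩
        add_mem' := by
          rintro a b ⟨z, hz, hza⟩ ⟨z', hz', hzb⟩
          refine ⟨z + z', add_mem hz hz', fun j => ?_⟩
          simp [hza, hzb, mul_add]
        neg_mem' := by
          rintro a ⟨z, hz, hza⟩
          refine ⟨-z, neg_mem hz, fun j => ?_⟩
          simp [hza] }
    have h0 : ∀ r, (w r + u r) - (w 0 + u 0) ∈ H := by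
      intro r
      refine Fin.cases ?_ (fun s => ?_) r
      · rw [sub_self]
        exact zero_mem _
      · refine ⟨rows s, Submodule.subset_span ⟨s, rfl⟩, fun j => ?_⟩
        simp only [hrows, hG, Pi.sub_apply, Int.cast_sub, dualLattice.coeff_apply, thetaForm]
        simp [mul_sub, mul_add]
    have hH := hgen H fun r r' => by
      have := sub_mem (h0 r) (h0 r')
      rwa [sub_sub_sub_cancel_right] at this
    refine top_unique fun z _ => ?_
    have hsingle : ∀ i, (Pi.single i 1 : Fin (Module.finrank ℤ N) → ℤ) ∈
        Submodule.span ℤ (range rows) := by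
      intro i
      obtain ⟨r, hr⟩ := hwN i
      obtain ⟨z, hz, hzr⟩ := hH r
      -- For the `w r` that yields the `i`-th dual basis form, the coordinate vector is the `i`-th
      -- unit vector.
      have : z = Pi.single i 1 := by
        ext j
        have h1 := (hzr j).trans (hr j)
        rw [Pi.single_apply]
        split_ifs at h1 ⊢ <;> exact_mod_cast h1
      exact this ▸ hz
    rw [pi_eq_sum_univ' z]
    exact sum_mem fun i _ => Submodule.smul_mem _ _ (by convert hsingle i using 1)

/-- The vectors used in the faithful embedding. -/
theorem exists_theta_vectors [DiscreteTopology N] [IsZLattice ℝ N] [DiscreteTopology Λ]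
    [IsZLattice ℝ Λ] {lam : Λ →+ dualLattice N} (hlam : ∀ u : Λ, (lam u).1 = Q u)
    (hp : ∀ x, x ≠ 0 → 0 < Q x x) {d : ℕ} (hd : d ≠ 0) :
    ∃ (k : ℕ) (w : Fin (k + 1) → V), (∀ r, (d : ℝ) • Q (w r) ∈ dualLattice N) ∧
      (∀ v : Λ, ∃ r, (d : ℝ)⁻¹ • (v : V) - w r ∈ Λ) ∧
      ∀ i, ∃ r, ∀ j, d * Q (w r) (latticeBasis N j) = if j = i then 1 else 0 := by
  have hd' : (d : ℝ) ≠ 0 := Nat.cast_ne_zero.2 hd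
  obtain ⟨R, hR⟩ := exists_forall_exists_norm_add_le Λ
  choose e he using fun i => surjective_of_posDef hp ((d : ℝ)⁻¹ • (latticeBasis N).coord i)
  have he' : ∀ i j, (d : ℝ) * Q (e i) (latticeBasis N j) = if j = i then 1 else 0 := by
    intro i j
    rw [he, LinearMap.smul_apply, smul_eq_mul, mul_inv_cancel_left₀ hd', Module.Basis.coord_apply,
      Module.Basis.repr_self, Finsupp.single_apply]
  -- Every class of `d⁻¹Λ` modulo `Λ` contains some `d⁻¹ v` of norm at most `R`, that is, with `‖v‖
  -- ≤ d R`. Repeated classes do no harm.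
  have := (finite_lattice_norm_le Λ (d * R)).to_subtype
  let κ := {u : Λ | ‖(u : V)‖ ≤ d * R} ⊕ Fin (Module.finrank ℤ N)
  let w' : κ → V := Sum.elim (fun u => (d : ℝ)⁻¹ • (u.1 : V)) e
  have hR0 : 0 ≤ R := by
    obtain ⟨u, hu⟩ := hR 0
    exact (norm_nonneg _).trans hu
  have hne : Nonempty κ := ⟨Sum.inl ⟨0, by
    change ‖((0 : Λ) : V)‖ ≤ _
    rw [ZeroMemClass.coe_zero, norm_zero]
    positivity⟩⟩
  obtain ⟨m, ⟨E⟩⟩ := Finite.exists_equiv_fin κ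
  cases m with
  | zero => exact (E hne.some).elim0
  | succ k =>
    refine ⟨k, w' ∘ E.symm, fun r => ?_, fun v => ?_, fun i => ⟨E (Sum.inr i), fun j => ?_⟩⟩
    · change (d : ℝ) • Q (w' (E.symm r)) ∈ _
      rcases E.symm r with u | i
      · change (d : ℝ) • Q ((d : ℝ)⁻¹ • (u.1 : V)) ∈ _
        rw [map_smul, smul_inv_smul₀ hd', ← hlam]
        exact (lam u.1).2
      · change (d : ℝ) • Q (e i) ∈ _
        rw [he, smul_inv_smul₀ hd']
        intro v hv
        have h1 := (latticeBasis N).mem_span_iff_repr_mem ℤ v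
        have h2 : Submodule.span ℤ (range (latticeBasis N)) = N :=
          Module.Basis.ofZLatticeBasis_span ℝ _ _
        rw [h2] at h1
        obtain ⟨z, hz⟩ := h1.1 hv i
        exact ⟨z, by simpa using hz.symm⟩
    · obtain ⟨u, hu⟩ := hR ((d : ℝ)⁻¹ • (v : V))
      have h1 : (d : ℝ)⁻¹ • ((v + (d : ℤ) • u : Λ) : V) = (d : ℝ)⁻¹ • (v : V) + u := by
        rw [Submodule.coe_add, Submodule.coe_smul, ← Int.cast_smul_eq_zsmul ℝ, Int.cast_natCast,
          smul_add, inv_smul_smul₀ hd']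
      have h2 : ‖((v + (d : ℤ) • u : Λ) : V)‖ ≤ d * R := by
        rw [← h1, norm_smul, norm_inv, Real.norm_natCast] at hu
        rwa [inv_mul_le_iff₀ (by positivity)] at hu
      refine ⟨E (Sum.inl ⟨_, h2⟩), ?_⟩
      rw [Function.comp_apply, E.symm_apply_apply]
      change _ - (d : ℝ)⁻¹ • ((v + (d : ℤ) • u : Λ) : V) ∈ Λ
      rw [h1, sub_add_cancel_left]
      exact neg_mem u.2
    · rw [Function.comp_apply, E.symm_apply_apply]
      exact he' i j

/-- Theta functions of degree at least `3` separate points. -/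
theorem sub_mem_of_theta_sub_eq [DiscreteTopology Λ] [IsZLattice ℝ Λ]
    (hs : ∀ x y, Q x y = Q y x) (hp : ∀ x, x ≠ 0 → 0 < Q x x) {e : V} {d k : ℕ} (hd : 3 ≤ d)
    {w : Fin (k + 1) → V} (hwΛ : ∀ v : Λ, ∃ r, (d : ℝ)⁻¹ • (v : V) - w r ∈ Λ) {v v' : V}
    (h : ∀ i : Fin k, theta Q Λ d e (w i.succ) v - theta Q Λ d e (w 0) v =
      theta Q Λ d e (w i.succ) v' - theta Q Λ d e (w 0) v') : v' - v ∈ Λ := by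
  have hd' : (d : ℝ) ≠ 0 := by positivity
  have h1 : ∀ r, theta Q Λ d e (w r) v - theta Q Λ d e (w r) v' =
      theta Q Λ d e (w 0) v - theta Q Λ d e (w 0) v' := by
    intro r
    refine Fin.cases rfl (fun i => ?_) r
    linarith [h i]
  -- The terms `q(x) + Q(e, x)` are the same for all `w` and only enter the common constant.
  have h2 : ∀ r, latMin Q Λ (v + e + w r) = latMin Q Λ (v' + e + w r) +
      (latMin Q Λ (v + e + w 0) - latMin Q Λ (v' + e + w 0)) := by
    intro r
    have h3 := h1 r
    simp only [theta, ← mul_sub] at h3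
    have h4 := mul_left_cancel₀ hd' h3
    linarith
  have h5 := sub_mem_of_latMin_sub_eq Λ hs hp hd (y := v + e) (y' := v' + e)
    (c := latMin Q Λ (v + e + w 0) - latMin Q Λ (v' + e + w 0)) fun x hx => by
      obtain ⟨r, hr⟩ := hwΛ ⟨_, hx⟩
      rw [inv_smul_smul₀ hd'] at hr
      have h6 : ∀ a, latMin Q Λ (a + x) = latMin Q Λ (a + w r) := fun a => by
        rw [← latMin_add Λ (a + w r) ⟨_, hr⟩]
        congr 1
        change a + x = a + w r + (x - w r)
        abel
      rw [h6, h6]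
      exact h2 r
  simpa using h5

end Main

theorem mainTheorem2 {V : Type u} [NormedAddCommGroup V] [NormedSpace ℝ V] [FiniteDimensional ℝ V]
    (N Λ : Submodule ℤ V) [DiscreteTopology N] [IsZLattice ℝ N]
    [DiscreteTopology Λ] [IsZLattice ℝ Λ]
    (hX : IsTropicalAbelianVariety N Λ)
    (L : TropicalLineBundle.{u, v} (RealTorus N Λ)) (hL : L.IsPositive)
    (d : ℕ) (hd : max 3 (2 * (Module.finrank ℝ V - 1).factorial) ≤ d) :
    (L.multiple d).AdmitsFaithfulEmbedding := by
  have hd3 : 3 ≤ d := (le_max_left _ _).trans hd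
  obtain ⟨D, ⟨Q, hQ, hs, hp⟩, hiso⟩ := hL
  have hlam := lam_eq_of_polarization hQ
  obtain ⟨e, he⟩ := exists_gam_eq D hQ hs (surjective_of_posDef hp)
  obtain ⟨k, w, hw, hwΛ, hwN⟩ := exists_theta_vectors hlam hp (by omega : d ≠ 0)
  have hθ : ∀ r, IsThetaFunction D d (theta Q Λ d e (w r)) := fun r =>
    isThetaFunction_theta D hlam hs hp he (hw r)
  obtain ⟨s, hsec⟩ := exists_sectionMap_eq hiso hθ
  choose r hr using RealTorus.exists_mk_eq (N := N) (Λ := Λ)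
  let ψ : RealTorus N Λ → Fin k → ℝ := fun x i =>
    theta Q Λ d e (w i.succ) (r x) - theta Q Λ d e (w 0) (r x)
  have hψ : ∀ v, ψ (RealTorus.mk N Λ v) =
      fun i => theta Q Λ d e (w i.succ) v - theta Q Λ d e (w 0) v := by
    intro v
    -- All the theta functions change by the same amount under `Λ`, so their differences are
    -- periodic and the choice of lift in `ψ` is immaterial.
    have hmem : r (RealTorus.mk N Λ v) - v ∈ Λ := RealTorus.mk_eq_mk.1 (hr _).symm
    ext i
    have h1 := (hθ i.succ).map_add v ⟨_, hmem⟩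
    have h2 := (hθ 0).map_add v ⟨_, hmem⟩
    simp only [add_sub_cancel] at h1 h2
    change _ - _ = _
    rw [h1, h2]
    ring
  have hcont : Continuous ψ := by
    have hq : IsQuotientMap (RealTorus.mk N Λ) := (RealTorus.isOpenMap_mk N Λ).isQuotientMap
      (RealTorus.continuous_mk N Λ) RealTorus.exists_mk_eq
    refine hq.continuous_iff.2 ?_
    rw [show ψ ∘ RealTorus.mk N Λ = _ from funext hψ]
    exact continuous_pi fun i => (hθ i.succ).continuous.sub (hθ 0).continuous
  have hinj : Function.Injective ψ := by
    intro x x' hxx'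
    obtain ⟨v, rfl⟩ := x.exists_mk_eq
    obtain ⟨v', rfl⟩ := x'.exists_mk_eq
    rw [hψ, hψ] at hxx'
    exact RealTorus.mk_eq_mk.2 (sub_mem_of_theta_sub_eq hs hp hd3 hwΛ fun i => congrFun hxx' i)
  have hmap : ∀ x, TropicalLineBundle.sectionMap s x = TropProj.ofReal (ψ x) := by
    intro x
    obtain ⟨v, rfl⟩ := x.exists_mk_eq
    rw [hsec, hψ]
  have := RealTorus.compactSpace N Λ
  refine ⟨k, s, ⟨ψ, hmap, isUnimodularMap_theta hlam hs hp e (by omega) hw hwΛ hwN hψ⟩, ?_⟩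
  rw [show TropicalLineBundle.sectionMap s = _ from funext hmap]
  exact TropProj.isEmbedding_ofReal_comp hcont hinj
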